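/- Write $dA=d^2z/\pi$, $\partial=\tfrac12(\partial_x-i\partial_y)$, $\Delta=\partial\bar\partial$, and for a potential $Q$ let $I_Q[\mu]=\iint\log\frac1{|z-w|}\,d\mu(z)\,d\mu(w)+\int Q\,d\mu$. For a closed set $S\subset\mathbb C$, a compact set $K$ is the droplet of $Q$ localised to $S$ if the measure $\Delta Q\,\mathbf 1_K\,dA$ has support $K$ and minimises $I_Q$ among the probability measures on $S$ (here $Q$ is $C^2$ near $K$); it is the (global) droplet of $Q$ if $S=\mathbb C$, and a local droplet of $Q$ if $S=\overline U$ for some open $U\supset K$. **Lemma 4.3.** Let $H$ be real and harmonic away from the poles of $\partial H$, with $\partial H$ rational, and let $J$ be a finite set of positive integers. For $t_0>0$ and $s=(s_j)_{j\in J}\in\mathbb C^J$ let $$Q_{t_0,s}(z)=\frac1{t_0}\Big(|z|^2-H(z)-2\operatorname{Re}\sum_{j\in J}\frac{s_j}{j}z^j\Big),$$ so that $s_j$ is the perturbation of the coefficient $t_j$; write $\partial/\partial t_j$ for the Wirtinger derivative $\partial/\partial s_j$. Let $V\subset(0,\infty)\times\mathbb C^J$ be open and, for every $(t_0,s)\in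 V$, let $K=K_{t_0,s}$ be a simply connected local droplet of $Q=Q_{t_0,s}$ (connected, with connected complement) such that the boundaries $\partial K$ are smooth Jordan curves varying smoothly with $(t_0,s)\in V$. Put $$\log\tau=-\iint_{K^2}\log\frac1{|z-\zeta|}\,dA(z)\,dA(\zeta)-t_0\int_KQ\,dA,\qquad M_j=\int_Kz^j\,dA .$$ Then at every point of $V$ the following derivatives exist and: 1. $\dfrac{\partial\log\tau}{\partial t_j}=\dfrac{M_j}{j}$ for every $j\in J$. 2. There is a constant $C_Q$ (the Robin constant of $K$) with $C_Q=\int_K\log\frac1{|z-\zeta|^2}\,dA(\zeta)+t_0Q(z)$ for all $z\in K$, and $\dfrac{\partial\log\tau}{\partial t_0}=-C_Q$. 3. If $0\in\operatorname{Int}K$, then the exterior harmonic moments $T_0=\frac1\pi\operatorname{area}K$ and $T_\ell=-\lim_{R\to\infty}\int_{\{|z|\le R\}\setminus K}z^{-\ell}\,dA$ ($\ell\ge1$) exist, and for all $\ell\ge0$ one has $\partial T_\ell/\partial t_j=\delta_{j\ell}$ and $\partial T_\ell/\partial\bar t_j=0$ for $j\in J$, and $\partial T_\ell/\partial t_0=\delta_{0\ell}$.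 4. If $K$ is the global droplet of $Q$ and $\mu_Q$ is the equilibrium measure of $Q$ (the minimiser of $I_Q$ among all probability measures on $\mathbb C$), then $\log\tau=-t_0^2\,I_Q[\mu_Q]$. -/

import Mathlib

open MeasureTheory Set Filter Topology
open scoped ContDiff

noncomputable section

namespace HeleShaw

/-! ### Potential theory in the plane -/

/-- The normalised area measure `dA = d²z / π`. -/
def area : Measure ℂ := ENNReal.ofReal Real.pi⁻¹ • (volume : Measure ℂ)

/-- `μ` has finite weighted logarithmic energy. A measure with an atom has infinite logarithmic
energy; atoms are excluded by hand because Lean's `log (1 / 0)` is `0` instead of `+∞`. -/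
def FiniteEnergy (Q : ℂ → ℝ) (μ : Measure ℂ) : Prop :=
  (∀ z, μ {z} = 0) ∧
  Integrable (fun x : ℂ × ℂ => Real.log (1 / ‖x.1 - x.2‖)) (μ.prod μ) ∧
  Integrable Q μ

/-- The weighted logarithmic energy `I_Q[μ]`. -/
def energy (Q : ℂ → ℝ) (μ : Measure ℂ) : ℝ :=
  (∫ x : ℂ × ℂ, Real.log (1 / ‖x.1 - x.2‖) ∂(μ.prod μ)) + ∫ z, Q z ∂μ

/-- `μ` is the equilibrium measure of the potential `Q · 1_S + ∞ · 1_{Sᶜ}`: it minimises the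
energy `I_Q` among the probability measures carried by `S` (those of infinite energy are never
competitive). For `S = univ` this is the equilibrium measure of `Q` itself. Measures of finite
energy do not charge points, so the values of `Q` on a finite set are irrelevant. -/
def IsEquilibriumMeasure (Q : ℂ → ℝ) (S : Set ℂ) (μ : Measure ℂ) : Prop :=
  IsProbabilityMeasure μ ∧ μ Sᶜ = 0 ∧ FiniteEnergy Q μ ∧
  ∀ ν : Measure ℂ, IsProbabilityMeasure ν → ν Sᶜ = 0 → FiniteEnergy Q ν →
    energy Q μ ≤ energy Q ν

/-- The measure `ΔQ · 1_K dA`, where `Δ = ∂ ∂̄` is a quarter of the usual Laplacian. -/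
def dropletMeasure (Q : ℂ → ℝ) (K : Set ℂ) : Measure ℂ :=
  (area.restrict K).withDensity (fun z => ENNReal.ofReal (Laplacian.laplacian Q z / 4))

/-- The compact set `K` is the droplet of the potential `Q · 1_S + ∞ · 1_{Sᶜ}`: the equilibrium
measure is `ΔQ · 1_K dA` and `K` is its support (`Q` being twice differentiable near `K`). -/
def IsDroplet (Q : ℂ → ℝ) (S K : Set ℂ) : Prop :=
  IsCompact K ∧ (∀ z ∈ K, ContDiffAt ℝ 2 Q z) ∧
  IsEquilibriumMeasure Q S (dropletMeasure Q K) ∧ (dropletMeasure Q K).support = K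

/-- `K` is a local droplet of `Q`: it is the droplet of the localisation of `Q` to the closure
of some open neighbourhood `U` of `K`. -/
def IsLocalDroplet (Q : ℂ → ℝ) (K : Set ℂ) : Prop :=
  ∃ U : Set ℂ, IsOpen U ∧ K ⊆ U ∧ IsDroplet Q (closure U) K

/-! ### Wirtinger derivatives and algebraic Hele-Shaw potentials -/

/-- The Wirtinger derivative `∂f = (f_x - i f_y) / 2`. -/
def dz (f : ℂ → ℂ) (z : ℂ) : ℂ :=
  (1 / 2) * (fderiv ℝ f z 1 - Complex.I * fderiv ℝ f z Complex.I)

/-- The Wirtinger derivative `∂̄f = (f_x + i f_y) / 2`. -/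
def dzbar (f : ℂ → ℂ) (z : ℂ) : ℂ :=
  (1 / 2) * (fderiv ℝ f z 1 + Complex.I * fderiv ℝ f z Complex.I)

/-- `H` is a real function, harmonic off the (finitely many) poles of a rational function
`num / den` in lowest terms, and `∂H = num / den` there. -/
def IsAlgebraic (H : ℂ → ℝ) : Prop :=
  ∃ num den : Polynomial ℂ, den ≠ 0 ∧ IsCoprime num den ∧
    ∀ z : ℂ, den.eval z ≠ 0 →
      InnerProductSpace.HarmonicAt H z ∧
      dz (fun w => (H w : ℂ)) z = num.eval z / den.eval z

/-- The algebraic Hele-Shaw potential `Q = (|z|² - H) / t₀`. -/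
def potential (t₀ : ℝ) (H : ℂ → ℝ) (z : ℂ) : ℝ := (1 / t₀) * (‖z‖ ^ 2 - H z)

/-- The times `(t₀, (s_j)_{j ∈ J})` that are being varied. -/
abbrev Times (J : Finset ℕ) : Type := ℝ × (J → ℂ)

/-- The perturbation `H + 2 Re ∑_{j ∈ J} s_j z^j / j`, in which every coefficient `t_j`, `j ∈ J`,
has been replaced by `t_j + s_j`. -/
def perturb (H : ℂ → ℝ) {J : Finset ℕ} (s : J → ℂ) (z : ℂ) : ℝ :=
  H z + 2 * (∑ j : J, s j / ((j : ℕ) : ℂ) * z ^ (j : ℕ)).re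

/-- The potential with times `p`. -/
def potentialAt (H : ℂ → ℝ) {J : Finset ℕ} (p : Times J) : ℂ → ℝ :=
  potential p.1 (perturb H p.2)

/-! ### Simply connected droplets and smooth families of them -/

/-- Simple connectivity of a compact subset of the plane: it is connected and has no holes. -/
def IsSimplyConnectedCompact (K : Set ℂ) : Prop :=
  IsCompact K ∧ IsConnected K ∧ IsConnected Kᶜ

/-- Over the parameter set `V`, the boundaries `∂(K p)` are smooth Jordan curves that vary
smoothly: they have regular, simple, `1`-periodic parametrisations which depend smoothly on the
parameter and the curve variable jointly. -/
def SmoothJordanBoundaries {E : Type*} [NormedAddCommGroup E] [NormedSpace ℝ E]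
    (V : Set E) (K : E → Set ℂ) : Prop :=
  ∃ γ : E → ℝ → ℂ,
    ContDiffOn ℝ ∞ (fun x : E × ℝ => γ x.1 x.2) (V ×ˢ (univ : Set ℝ)) ∧
    ∀ p ∈ V, Function.Periodic (γ p) 1 ∧ InjOn (γ p) (Ico 0 1) ∧
      (∀ θ, deriv (γ p) θ ≠ 0) ∧ range (γ p) = frontier (K p)

/-- A family of simply connected local droplets, for the times `p ∈ V`, whose boundaries vary
smoothly. -/
def IsSmoothDropletFamily (H : ℂ → ℝ) {J : Finset ℕ} (V : Set (Times J))
    (K : Times J → Set ℂ) : Prop :=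
  (∀ p ∈ V, 0 < p.1 ∧ IsLocalDroplet (potentialAt H p) (K p) ∧
    IsSimplyConnectedCompact (K p)) ∧
  SmoothJordanBoundaries V K

/-! ### Moments, Robin constant, tau-function -/

/-- The truncation `-∫_{{|z| ≤ R} \ K} z^{-l} dA` of the exterior moment. -/
def truncatedMoment (K : Set ℂ) (l : ℕ) (R : ℝ) : ℂ :=
  -∫ z in Metric.closedBall (0 : ℂ) R \ K, (z ^ l)⁻¹ ∂area

/-- The exterior harmonic moments `t₀ = area(K) / π` and `t_l = -∫_{Kᶜ} z^{-l} dA`, `l ≥ 1`; the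
integrals are improper at infinity (for `l = 1, 2` they converge only conditionally). -/
def harmonicMoment (K : Set ℂ) (l : ℕ) : ℂ :=
  if l = 0 then ((area K).toReal : ℂ) else limUnder atTop (truncatedMoment K l)

/-- The interior harmonic moments `M_j = ∫_K z^j dA`. -/
def interiorMoment (K : Set ℂ) (j : ℕ) : ℂ := ∫ z in K, z ^ j ∂area

/-- `C` is the (modified) Robin constant of the local droplet `K` of `Q`. -/
def IsRobinConstant (t₀ : ℝ) (Q : ℂ → ℝ) (K : Set ℂ) (C : ℝ) : Prop :=
  ∀ z ∈ K, C = (∫ ζ in K, Real.log (1 / ‖z - ζ‖ ^ 2) ∂area) + t₀ * Q z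

/-- `log τ = -∫∫_{K²} log (1 / |z - ζ|) dA dA - t₀ ∫_K Q dA`. -/
def logTau (t₀ : ℝ) (Q : ℂ → ℝ) (K : Set ℂ) : ℝ :=
  -(∫ z in K, ∫ ζ in K, Real.log (1 / ‖z - ζ‖) ∂area ∂area) - t₀ * ∫ z in K, Q z ∂area

/-- The restriction of a function of the times to the complex line through `p` along which only
the `j`-th time varies. -/
def slice {J : Finset ℕ} (F : Times J → ℂ) (p : Times J) (j : J) (s : ℂ) : ℂ :=
  F (p.1, Function.update p.2 j s)

/-- `log τ` as a function of the times. -/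
def logTauAt (H : ℂ → ℝ) {J : Finset ℕ} (K : Times J → Set ℂ) (p : Times J) : ℝ :=
  logTau p.1 (potentialAt H p) (K p)

end HeleShaw

end

noncomputable section

namespace HeleShaw

/-! ### The logarithmic potential of a bounded set -/

/-! Write `W = t₀ Q` and `L_A(z) = ∫_A log |z - ζ| dA(ζ)`, so that `log τ = ∫_K L_K dA - ∫_K W dA`.
Away from the poles `t₀ ΔQ = 1`, so the equilibrium measure is `1_K dA / t₀`. Hence `area K = t₀`,
and `log τ` is `-t₀²` times the minimal energy when `K` is the global droplet.

Robin constant: perturbing the equilibrium measure `μ` to `(1 + ε g) μ` and letting `ε → 0` shows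
that `-2 L_K + W` is constant on `K` (`robin_of_isDroplet`).

Derivatives of `log τ` (`hasFDerivAt_logTauAt`): no formula for the velocity of the boundary is
needed. With `Φ = -2 L_{K p} + W_p - C`, symmetry of the kernel gives that `log τ(q) - log τ(p)`
equals the difference of the integrals of `L_{K q} - L_{K p}` over `K q` and `K p`, minus that of
`Φ`, minus `C (q₀ - p₀)`, minus `∫_{K q} (W_q - W_p)`. The first two terms are integrals over the
symmetric difference, of area `O(‖q - p‖)`, of functions that are uniformly small there, so they are
`o(‖q - p‖)`. The last two yield the linear part, by continuity of the moments.

The area estimate (`eventually_area_symmDiff_le`) comes from the moving boundary: a point outside a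
thin tube around the curve of `p` is crossed by no nearby curve, so its membership in `K` does not
change. This needs membership to be locally constant in the parameter off the boundary: outside
points stay outside by connectedness of the complement, and interior discs stay inside by continuity
of the area.

Exterior moments (`harmonicMoment_sub`): if two droplets contain a common disc about `0`,
subtracting their Robin equations there removes `|z|²`, `H` and the potential of the disc. What
remains is the real part of a power series with coefficients `((T_k' - s_k') - (T_k - s_k)) / k`,
and it is constant. So `T_k - s_k` is locally constant for `k ≥ 1`. -/

instance isAddHaarMeasure_area : Measure.IsAddHaarMeasure area :=
  Measure.IsAddHaarMeasure.smul _ (by simp [Real.pi_pos]) ENNReal.ofReal_ne_top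

lemma area_lt_top_of_subset_ball {A : Set ℂ} {R : ℝ} (hA : A ⊆ Metric.ball 0 R) : area A < ⊤ :=
  (measure_mono hA).trans_lt measure_ball_lt_top

/-- In polar coordinates the integrand becomes `r log r`, which extends continuously to `r = 0`. -/
lemma integrableOn_log_norm (R : ℝ) :
    IntegrableOn (fun z : ℂ => Real.log ‖z‖) (Metric.ball 0 R) area := by
  rw [integrableOn_fun_norm_addHaar area (f := Real.log)]
  simp only [Complex.finrank_real_complex, Nat.add_one_sub_one, pow_one, smul_eq_mul]
  exact (Real.continuous_mul_log.integrableOn_Icc (a := 0) (b := R)).mono_set Ioo_subset_Icc_self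

lemma preimage_sub_subset_ball {A : Set ℂ} {R : ℝ} (hA : A ⊆ Metric.ball 0 R) {z : ℂ}
    (hz : z ∈ Metric.ball (0 : ℂ) R) : (fun ζ => z - ζ) ⁻¹' A ⊆ Metric.ball 0 (2 * R) := by
  intro w hw
  have h1 := hA hw
  simp only [Metric.mem_ball, dist_zero_right] at *
  calc ‖w‖ = ‖z - (z - w)‖ := by simp
    _ ≤ ‖z‖ + ‖z - w‖ := norm_sub_le _ _
    _ < 2 * R := by linarith

lemma measurePreserving_sub (z : ℂ) : MeasurePreserving (fun ζ : ℂ => z - ζ) area area :=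
  Measure.measurePreserving_sub_left area z

lemma setIntegral_comp_sub (f : ℂ → ℝ) (A : Set ℂ) (z : ℂ) :
    ∫ ζ in A, f (z - ζ) ∂area = ∫ w in (fun ζ => z - ζ) ⁻¹' A, f w ∂area := by
  have h := (measurePreserving_sub z).setIntegral_preimage_emb
    (MeasurableEquiv.subLeft z).measurableEmbedding f ((fun ζ => z - ζ) ⁻¹' A)
  have h2 : (fun ζ => z - ζ) ⁻¹' ((fun ζ => z - ζ) ⁻¹' A) = A := by
    ext; simp
  rw [h2] at h
  exact h

lemma integrableOn_comp_sub {f : ℂ → ℝ} {A : Set ℂ} {z : ℂ}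
    (hf : IntegrableOn f ((fun ζ => z - ζ) ⁻¹' A) area) :
    IntegrableOn (fun ζ => f (z - ζ)) A area := by
  have h := (measurePreserving_sub z).integrableOn_comp_preimage (f := f)
    (s := (fun ζ => z - ζ) ⁻¹' A)
    (MeasurableEquiv.subLeft z).measurableEmbedding
  have h2 : (fun ζ => z - ζ) ⁻¹' ((fun ζ => z - ζ) ⁻¹' A) = A := by
    ext; simp
  rw [h2] at h
  exact h.2 hf

lemma exists_ball_zero_of_isBounded {A : Set ℂ} (hA : Bornology.IsBounded A) (z : ℂ) :
    ∃ R, A ⊆ Metric.ball 0 R ∧ z ∈ Metric.ball (0 : ℂ) R := by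
  obtain ⟨R, hR⟩ := ((Bornology.isBounded_singleton (x := z)).union hA).subset_ball 0
  exact ⟨R, subset_union_right.trans hR, hR (by simp)⟩

lemma integrableOn_log_sub {A : Set ℂ} (hA : Bornology.IsBounded A) (z : ℂ) :
    IntegrableOn (fun ζ => Real.log ‖z - ζ‖) A area := by
  obtain ⟨R, hR, hz⟩ := exists_ball_zero_of_isBounded hA z
  exact integrableOn_comp_sub (f := fun w => Real.log ‖w‖)
    ((integrableOn_log_norm (2 * R)).mono_set (preimage_sub_subset_ball hR hz))

lemma setIntegral_abs_log_le {A : Set ℂ} {R : ℝ} (hA : A ⊆ Metric.ball 0 R) {z : ℂ}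
    (hz : z ∈ Metric.ball (0 : ℂ) R) :
    ∫ ζ in A, |Real.log ‖z - ζ‖| ∂area ≤ ∫ w in Metric.ball 0 (2 * R), |Real.log ‖w‖| ∂area := by
  rw [setIntegral_comp_sub (fun w => |Real.log ‖w‖|)]
  exact setIntegral_mono_set (integrableOn_log_norm _).norm (ae_of_all _ fun _ => abs_nonneg _)
    (preimage_sub_subset_ball hA hz).eventuallyLE

/-- Uniformity in `z` comes from translating the singularity to the origin: every integral becomes
one of the fixed integrable function `|log ‖w‖|` over a subset of the ball of radius `2R`, and
absolute continuity of that single integral applies. -/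
lemma exists_setIntegral_abs_log_lt (R : ℝ) {ε : ℝ} (hε : 0 < ε) :
    ∃ δ > 0, ∀ A ⊆ Metric.ball (0 : ℂ) R, area A < δ → ∀ z ∈ Metric.ball (0 : ℂ) R,
      ∫ ζ in A, |Real.log ‖z - ζ‖| ∂area < ε := by
  have hI := integrableOn_log_norm (2 * R)
  obtain ⟨δ, hδ, h⟩ := exists_pos_setLIntegral_lt_of_measure_lt
    (μ := area.restrict (Metric.ball 0 (2 * R))) (f := fun w : ℂ => ‖Real.log ‖w‖‖ₑ)
    hI.2.ne (ε := ENNReal.ofReal ε) (by simpa using hε)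
  refine ⟨δ, hδ, fun A hA hAδ z hz => ?_⟩
  rw [setIntegral_comp_sub (fun w => |Real.log ‖w‖|)]
  have hsub := preimage_sub_subset_ball hA hz
  have hI' := hI.mono_set hsub
  have h1 := h ((fun ζ => z - ζ) ⁻¹' A) <| by
    refine (Measure.restrict_apply_le _ _).trans_lt ?_
    rwa [(measurePreserving_sub z).measure_preimage_emb
      (MeasurableEquiv.subLeft z).measurableEmbedding]
  rw [Measure.restrict_restrict_of_subset hsub, ← ofReal_integral_norm_eq_lintegral_enorm hI',
    ENNReal.ofReal_lt_ofReal_iff hε] at h1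
  exact h1

/-- The integral `∫_A log |z - ζ| dA(ζ)`. -/
def logPot (A : Set ℂ) (z : ℂ) : ℝ := ∫ ζ in A, Real.log ‖z - ζ‖ ∂area

/-- After the substitution `w = z - ζ` the singular kernel no longer depends on `z`; only the domain
`z - A` moves, and its indicator converges off the null set `z₀ - ∂A`. Dominated convergence
concludes. -/
lemma continuous_logPot {A : Set ℂ} (hA : IsCompact A) (hA0 : area (frontier A) = 0) :
    Continuous (logPot A) := by
  rw [continuous_iff_continuousAt]
  intro z₀
  obtain ⟨R, hR, hz₀⟩ := exists_ball_zero_of_isBounded hA.isBounded z₀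
  have hmeas : ∀ z : ℂ, MeasurableSet ((fun ζ => z - ζ) ⁻¹' A) := fun z =>
    (measurePreserving_sub z).measurable hA.measurableSet
  have heq : logPot A = fun z => ∫ w, ((fun ζ => z - ζ) ⁻¹' A).indicator
      (fun w => Real.log ‖w‖) w ∂area := by
    ext z
    rw [integral_indicator (hmeas z), ← setIntegral_comp_sub (fun w => Real.log ‖w‖), logPot]
  rw [heq]
  refine continuousAt_of_dominated (bound := (Metric.ball 0 (2 * R)).indicator
    fun w => |Real.log ‖w‖|) ?_ ?_ ?_ ?_
  · exact Eventually.of_forall fun z =>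
      ((measurable_norm.log).indicator (hmeas z)).aestronglyMeasurable
  · filter_upwards [Metric.isOpen_ball.mem_nhds hz₀] with z hz
    refine ae_of_all _ fun w => ?_
    rw [norm_indicator_eq_indicator_norm]
    exact indicator_le_indicator_of_subset (preimage_sub_subset_ball hR hz)
      (fun _ => norm_nonneg _) _
  · rw [integrable_indicator_iff measurableSet_ball]
    exact (integrableOn_log_norm _).norm
  · have hnull : ∀ᵐ w ∂area, z₀ - w ∉ frontier A := by
      rw [← (measurePreserving_sub z₀).measure_preimage_emb
        (MeasurableEquiv.subLeft z₀).measurableEmbedding] at hA0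
      exact measure_eq_zero_iff_ae_notMem.1 hA0
    filter_upwards [hnull] with w hw
    have hev : ∀ᶠ z in 𝓝 z₀, (z - w ∈ A ↔ z₀ - w ∈ A) := by
      have hc : Tendsto (fun z => z - w) (𝓝 z₀) (𝓝 (z₀ - w)) :=
        (continuous_id.sub continuous_const).tendsto _
      rw [hA.isClosed.frontier_eq, Set.mem_sdiff, not_and_not_right] at hw
      by_cases h : z₀ - w ∈ A
      · filter_upwards [hc (isOpen_interior.mem_nhds (hw h))] with z hz
        exact ⟨fun _ => h, fun _ => interior_subset hz⟩
      · filter_upwards [hc (hA.isClosed.isOpen_compl.mem_nhds h)] with z hz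
        exact ⟨fun h' => absurd h' hz, fun h' => absurd h' h⟩
    refine (continuousAt_const (y := ((fun ζ => z₀ - ζ) ⁻¹' A).indicator
      (fun w => Real.log ‖w‖) w)).congr ?_
    filter_upwards [hev] with z hz
    by_cases h : z₀ - w ∈ A
    · rw [indicator_of_mem (show w ∈ (fun ζ => z₀ - ζ) ⁻¹' A from h),
        indicator_of_mem (show w ∈ (fun ζ => z - ζ) ⁻¹' A from hz.2 h)]
    · rw [indicator_of_notMem (show w ∉ (fun ζ => z₀ - ζ) ⁻¹' A from h),
        indicator_of_notMem (show w ∉ (fun ζ => z - ζ) ⁻¹' A from fun h' => h (hz.1 h'))]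

lemma measurable_log_norm_sub : Measurable fun x : ℂ × ℂ => Real.log ‖x.1 - x.2‖ :=
  (measurable_fst.sub measurable_snd).norm.log

lemma integrable_log_prod {A B : Set ℂ} {R : ℝ} (hA : A ⊆ Metric.ball 0 R)
    (hB : B ⊆ Metric.ball 0 R) (hAm : MeasurableSet A) :
    Integrable (fun x : ℂ × ℂ => Real.log ‖x.1 - x.2‖)
      ((area.restrict A).prod (area.restrict B)) := by
  rw [integrable_prod_iff measurable_log_norm_sub.aestronglyMeasurable]
  have : IsFiniteMeasure (area.restrict A) := ⟨by simpa using area_lt_top_of_subset_ball hA⟩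
  refine ⟨ae_of_all _ fun z => integrableOn_log_sub (Metric.isBounded_ball.subset hB) z, ?_⟩
  refine Integrable.of_bound (C := ∫ w in Metric.ball 0 (2 * R), |Real.log ‖w‖| ∂area)
    measurable_log_norm_sub.norm.aestronglyMeasurable.integral_prod_right' ?_
  filter_upwards [ae_restrict_mem hAm] with z hz
  rw [Real.norm_of_nonneg (integral_nonneg fun _ => norm_nonneg _)]
  exact setIntegral_abs_log_le hB (hA hz)

lemma setIntegral_logPot_comm {A B : Set ℂ} {R : ℝ} (hA : A ⊆ Metric.ball 0 R)
    (hB : B ⊆ Metric.ball 0 R) (hAm : MeasurableSet A) :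
    ∫ z in A, logPot B z ∂area = ∫ z in B, logPot A z ∂area := by
  have h := integral_integral_swap (f := fun z ζ : ℂ => Real.log ‖z - ζ‖)
    (integrable_log_prod hA hB hAm)
  simp only [logPot]
  rw [h]
  simp_rw [norm_sub_rev]

lemma integrableOn_logPot {A B : Set ℂ} {R : ℝ} (hA : A ⊆ Metric.ball 0 R)
    (hB : B ⊆ Metric.ball 0 R) (hAm : MeasurableSet A) : IntegrableOn (logPot B) A area :=
  (integrable_log_prod hA hB hAm).integral_prod_left


/-! ### The Euler-Lagrange equation -/

lemma eq_zero_of_quadratic_nonneg {B D : ℝ}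
    (h : ∀ ε : ℝ, |ε| ≤ 1 / 2 → 0 ≤ ε * B + ε ^ 2 * D) : B = 0 := by
  have hlim (c : ℝ) : Tendsto (fun ε : ℝ => c * B + ε * D) (𝓝[>] 0) (𝓝 (c * B)) := by
    have h : Tendsto (fun ε : ℝ => c * B + ε * D) (𝓝 0) (𝓝 (c * B + 0 * D)) :=
      Continuous.tendsto (by fun_prop) 0
    simpa using h.mono_left nhdsWithin_le_nhds
  have hev : ∀ᶠ ε : ℝ in 𝓝[>] 0, ε ∈ Ioo (0 : ℝ) (1 / 2) := Ioo_mem_nhdsGT (by norm_num)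
  have h1 : 0 ≤ 1 * B := by
    refine ge_of_tendsto (hlim 1) ?_
    filter_upwards [hev] with ε hε
    have := h ε (by rw [abs_of_pos hε.1]; exact hε.2.le)
    refine nonneg_of_mul_nonneg_right (a := ε) ?_ hε.1
    nlinarith
  have h2 : 0 ≤ -1 * B := by
    refine ge_of_tendsto (hlim (-1)) ?_
    filter_upwards [hev] with ε hε
    have := h (-ε) (by rw [abs_neg, abs_of_pos hε.1]; exact hε.2.le)
    refine nonneg_of_mul_nonneg_right (a := ε) ?_ hε.1
    nlinarith
  linarith

section FirstVariation

variable {Q : ℂ → ℝ} {S : Set ℂ} {μ : Measure ℂ} {g : ℂ → ℝ}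

/-- The measure `(1 + ε g) μ`. -/
def tilt (μ : Measure ℂ) (g : ℂ → ℝ) (ε : ℝ) : Measure ℂ :=
  μ.withDensity fun z => ENNReal.ofReal (1 + ε * g z)

lemma tilt_density_nonneg (hg : ∀ z, |g z| ≤ 1) {ε : ℝ} (hε : |ε| ≤ 1 / 2) (z : ℂ) :
    0 ≤ 1 + ε * g z := by
  have h : |ε * g z| ≤ 1 / 2 * 1 := by
    rw [abs_mul]
    exact mul_le_mul hε (hg z) (abs_nonneg _) (by norm_num)
  linarith [neg_abs_le (ε * g z)]

lemma measurable_tilt_density (hgm : Measurable g) (ε : ℝ) :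
    Measurable fun z => ENNReal.ofReal (1 + ε * g z) := by fun_prop

lemma integral_tilt (hgm : Measurable g) (hg : ∀ z, |g z| ≤ 1) {ε : ℝ} (hε : |ε| ≤ 1 / 2)
    (f : ℂ → ℝ) : ∫ z, f z ∂(tilt μ g ε) = ∫ z, (1 + ε * g z) * f z ∂μ := by
  rw [tilt, integral_withDensity_eq_integral_toReal_smul (measurable_tilt_density hgm ε)
    (by simp)]
  simp_rw [ENNReal.toReal_ofReal (tilt_density_nonneg hg hε _), smul_eq_mul]

lemma integrable_bdd_mul {α : Type*} [MeasurableSpace α] {m : Measure α} {a f : α → ℝ} {c : ℝ}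
    (ha : Measurable a) (hac : ∀ x, |a x| ≤ c) (hf : Integrable f m) :
    Integrable (fun x => a x * f x) m :=
  hf.bdd_mul ha.aestronglyMeasurable (ae_of_all _ hac)

lemma integrable_tilt (hgm : Measurable g) (hg : ∀ z, |g z| ≤ 1) {ε : ℝ} (hε : |ε| ≤ 1 / 2)
    {f : ℂ → ℝ} (hf : Integrable f μ) : Integrable f (tilt μ g ε) := by
  rw [tilt, integrable_withDensity_iff_integrable_smul' (measurable_tilt_density hgm ε)
    (by simp)]
  simp_rw [ENNReal.toReal_ofReal (tilt_density_nonneg hg hε _), smul_eq_mul]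
  have : (fun x => (1 + ε * g x) * f x) = fun x => f x + ε * (g x * f x) := by ext; ring
  rw [this]
  exact hf.add ((integrable_bdd_mul hgm hg hf).const_mul ε)

lemma tilt_prod [SFinite μ] (hgm : Measurable g) (ε : ℝ) :
    (tilt μ g ε).prod (tilt μ g ε) = (μ.prod μ).withDensity fun x =>
      ENNReal.ofReal (1 + ε * g x.1) * ENNReal.ofReal (1 + ε * g x.2) :=
  prod_withDensity (measurable_tilt_density hgm ε) (measurable_tilt_density hgm ε)

lemma measurable_tilt_prod_density (hgm : Measurable g) (ε : ℝ) :
    Measurable fun x : ℂ × ℂ =>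
      ENNReal.ofReal (1 + ε * g x.1) * ENNReal.ofReal (1 + ε * g x.2) :=
  ((measurable_tilt_density hgm ε).comp measurable_fst).mul
    ((measurable_tilt_density hgm ε).comp measurable_snd)

lemma tilt_prod_density_lt_top (ε : ℝ) (x : ℂ × ℂ) :
    ENNReal.ofReal (1 + ε * g x.1) * ENNReal.ofReal (1 + ε * g x.2) < ⊤ :=
  ENNReal.mul_lt_top ENNReal.ofReal_lt_top ENNReal.ofReal_lt_top

/-- The energy of `(1 + ε g) μ` is a quadratic polynomial in `ε`; at an equilibrium measure its
linear coefficient vanishes. -/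
lemma isEquilibriumMeasure_first_variation (hμ : IsEquilibriumMeasure Q S μ)
    (hgm : Measurable g) (hg : ∀ z, |g z| ≤ 1) (hg0 : ∫ z, g z ∂μ = 0) :
    ∫ z, g z * (2 * ∫ ζ, Real.log (1 / ‖z - ζ‖) ∂μ + Q z) ∂μ = 0 := by
  obtain ⟨hprob, hS, ⟨hat, hL, hQ⟩, hmin⟩ := hμ
  set L : ℂ × ℂ → ℝ := fun x => Real.log (1 / ‖x.1 - x.2‖) with hLdef
  have hgi : Integrable g μ := by
    simpa using integrable_bdd_mul (f := fun _ => (1 : ℝ)) hgm hg (integrable_const (μ := μ) 1)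
  have hg1 : Integrable (fun x : ℂ × ℂ => g x.1 * L x) (μ.prod μ) :=
    integrable_bdd_mul (hgm.comp measurable_fst) (fun x => hg x.1) hL
  have hg2 : Integrable (fun x : ℂ × ℂ => g x.2 * L x) (μ.prod μ) :=
    integrable_bdd_mul (hgm.comp measurable_snd) (fun x => hg x.2) hL
  have hg12 : Integrable (fun x : ℂ × ℂ => g x.1 * (g x.2 * L x)) (μ.prod μ) :=
    integrable_bdd_mul (hgm.comp measurable_fst) (fun x => hg x.1) hg2
  have hgQ : Integrable (fun z => g z * Q z) μ := integrable_bdd_mul hgm hg hQ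
  have hP : Integrable (fun z => ∫ ζ, L (z, ζ) ∂μ) μ := hL.integral_prod_left
  have hI1 : ∫ x, g x.1 * L x ∂(μ.prod μ) = ∫ z, g z * ∫ ζ, L (z, ζ) ∂μ ∂μ := by
    rw [integral_prod _ hg1]
    simp_rw [integral_const_mul]
  have hI2 : ∫ x, g x.2 * L x ∂(μ.prod μ) = ∫ z, g z * ∫ ζ, L (z, ζ) ∂μ ∂μ := by
    rw [integral_prod_symm _ hg2]
    simp_rw [integral_const_mul]
    simp only [hLdef]
    simp_rw [norm_sub_rev]
  have hB : ∫ z, g z * (2 * ∫ ζ, L (z, ζ) ∂μ + Q z) ∂μ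
      = 2 * (∫ z, g z * ∫ ζ, L (z, ζ) ∂μ ∂μ) + ∫ z, g z * Q z ∂μ := by
    rw [← integral_const_mul, ← integral_add ((integrable_bdd_mul hgm hg hP).const_mul 2) hgQ]
    congr 1 with z
    ring
  refine eq_zero_of_quadratic_nonneg (D := ∫ x, g x.1 * (g x.2 * L x) ∂(μ.prod μ)) ?_
  intro ε hε
  have hpos := tilt_density_nonneg (g := g) hg hε
  have hden : ∀ x : ℂ × ℂ, (ENNReal.ofReal (1 + ε * g x.1) * ENNReal.ofReal (1 + ε * g x.2)).toReal
      * L x = (L x + ε * (g x.1 * L x)) + (ε * (g x.2 * L x) + ε ^ 2 * (g x.1 * (g x.2 * L x))) := by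
    intro x
    rw [ENNReal.toReal_mul, ENNReal.toReal_ofReal (hpos _), ENNReal.toReal_ofReal (hpos _)]
    ring
  have hLi : Integrable L ((tilt μ g ε).prod (tilt μ g ε)) := by
    rw [tilt_prod hgm, integrable_withDensity_iff_integrable_smul'
      (measurable_tilt_prod_density hgm ε) (ae_of_all _ (tilt_prod_density_lt_top ε))]
    simp_rw [smul_eq_mul, hden]
    exact (hL.add (hg1.const_mul ε)).add ((hg2.const_mul ε).add (hg12.const_mul (ε ^ 2)))
  have hLe : ∫ x, L x ∂((tilt μ g ε).prod (tilt μ g ε)) = (∫ x, L x ∂(μ.prod μ))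
      + 2 * ε * (∫ z, g z * ∫ ζ, L (z, ζ) ∂μ ∂μ)
      + ε ^ 2 * ∫ x, g x.1 * (g x.2 * L x) ∂(μ.prod μ) := by
    rw [tilt_prod hgm, integral_withDensity_eq_integral_toReal_smul
      (measurable_tilt_prod_density hgm ε) (ae_of_all _ (tilt_prod_density_lt_top ε))]
    simp_rw [smul_eq_mul, hden]
    have hf1 : Integrable (fun x => L x + ε * (g x.1 * L x)) (μ.prod μ) :=
      hL.add (hg1.const_mul ε)
    have hf2 : Integrable (fun x => ε * (g x.2 * L x) + ε ^ 2 * (g x.1 * (g x.2 * L x)))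
        (μ.prod μ) := (hg2.const_mul ε).add (hg12.const_mul (ε ^ 2))
    rw [integral_add hf1 hf2, integral_add hL (hg1.const_mul ε), integral_add (hg2.const_mul ε) (hg12.const_mul (ε ^ 2)),
      integral_const_mul, integral_const_mul, integral_const_mul, hI1, hI2]
    ring
  have hQe : ∫ z, Q z ∂(tilt μ g ε) = (∫ z, Q z ∂μ) + ε * ∫ z, g z * Q z ∂μ := by
    rw [integral_tilt hgm hg hε, ← integral_const_mul, ← integral_add hQ (hgQ.const_mul ε)]
    congr 1 with z
    ring
  -- Absolute continuity makes the perturbed measure an admissible competitor: it stays carried by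
  -- `S` and has no atoms.
  have hac : tilt μ g ε ≪ μ := withDensity_absolutelyContinuous _ _
  have hνprob : IsProbabilityMeasure (tilt μ g ε) := by
    constructor
    have hf : Integrable (fun z => 1 + ε * g z) μ := (integrable_const 1).add (hgi.const_mul ε)
    rw [tilt, withDensity_apply _ MeasurableSet.univ, setLIntegral_univ,
      ← ofReal_integral_eq_lintegral_ofReal hf (ae_of_all _ hpos), integral_add (integrable_const 1) (hgi.const_mul ε),
      integral_const_mul, hg0]
    simp
  have h := hmin (tilt μ g ε) hνprob (hac hS)
    ⟨fun z => hac (hat z), hLi, integrable_tilt hgm hg hε hQ⟩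
  simp only [energy] at h
  rw [hLe, hQe] at h
  rw [hB]
  linarith

end FirstVariation

/-- At an equilibrium measure `μ` whose support `K` is compact, the effective potential is
constant on `K`. -/
lemma isEquilibriumMeasure_const_on_support {Q : ℂ → ℝ} {S K : Set ℂ} {μ : Measure ℂ}
    (hμ : IsEquilibriumMeasure Q S μ) (hK : IsCompact K) (hsupp : μ.support = K)
    (hc : ContinuousOn (fun z => 2 * ∫ ζ, Real.log (1 / ‖z - ζ‖) ∂μ + Q z) K) :
    ∃ C : ℝ, ∀ z ∈ K, 2 * ∫ ζ, Real.log (1 / ‖z - ζ‖) ∂μ + Q z = C := by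
  have := hμ.1
  set Φ : ℂ → ℝ := fun z => 2 * ∫ ζ, Real.log (1 / ‖z - ζ‖) ∂μ + Q z with hΦ
  set m := ∫ z, Φ z ∂μ with hm
  have hKae : ∀ᵐ z ∂μ, z ∈ K := hsupp ▸ Measure.support_mem_ae
  obtain ⟨M₀, hM₀⟩ := hK.exists_bound_of_continuousOn (hc.sub (continuousOn_const (c := m)))
  set M := max M₀ 1 with hM
  have hMpos : 0 < M := lt_max_of_lt_right one_pos
  -- The test function is the deviation of `Φ` from its own mean, scaled to be bounded by `1`; the
  -- first variation then says `M ∫ g² dμ = 0`.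
  set g : ℂ → ℝ := K.indicator fun z => (Φ z - m) / M with hgdef
  have hcg : ContinuousOn (fun z => (Φ z - m) / M) K :=
    (hc.sub continuousOn_const).div_const M
  have hgm : Measurable g := by
    classical
    have := hcg.measurable_piecewise (continuousOn_const (c := (0 : ℝ)) (s := Kᶜ))
      hK.measurableSet
    rw [hgdef, ← piecewise_eq_indicator]
    exact this
  have hg : ∀ z, |g z| ≤ 1 := by
    intro z
    by_cases hz : z ∈ K
    · rw [hgdef, indicator_of_mem hz, abs_div, abs_of_pos hMpos, div_le_one hMpos]
      exact (hM₀ z hz).trans (le_max_left _ _)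
    · rw [hgdef, indicator_of_notMem hz]
      simp
  have hgae : ∀ᵐ z ∂μ, g z = (Φ z - m) / M := by
    filter_upwards [hKae] with z hz
    rw [hgdef, indicator_of_mem hz]
  have hgi : Integrable g μ := by
    simpa using integrable_bdd_mul (f := fun _ => (1 : ℝ)) hgm hg (integrable_const (μ := μ) 1)
  have hΦg : ∀ᵐ z ∂μ, Φ z = M * g z + m := by
    filter_upwards [hgae] with z hz
    rw [hz]
    field_simp
    ring
  have hg0 : ∫ z, g z ∂μ = 0 := by
    have h1 : m = M * ∫ z, g z ∂μ + m := by
      conv_lhs => rw [hm, integral_congr_ae hΦg]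
      rw [integral_add (hgi.const_mul M) (integrable_const m), integral_const_mul]
      simp
    have h2 : M * ∫ z, g z ∂μ = 0 := by linarith
    exact (mul_eq_zero.1 h2).resolve_left hMpos.ne'
  have hgg : Integrable (fun z => g z * g z) μ := integrable_bdd_mul hgm hg hgi
  have h0 : ∫ z, g z * g z ∂μ = 0 := by
    have h1 := isEquilibriumMeasure_first_variation hμ hgm hg hg0
    have h2 : ∫ z, g z * Φ z ∂μ = M * ∫ z, g z * g z ∂μ + m * ∫ z, g z ∂μ := by
      rw [← integral_const_mul, ← integral_const_mul,
        ← integral_add (hgg.const_mul M) (hgi.const_mul m)]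
      refine integral_congr_ae ?_
      filter_upwards [hΦg] with z hz
      rw [hz]
      ring
    rw [h2, hg0, mul_zero, add_zero] at h1
    exact (mul_eq_zero.1 h1).resolve_left hMpos.ne'
  have hae : ∀ᵐ z ∂μ, Φ z = m := by
    rw [integral_eq_zero_iff_of_nonneg (fun z => mul_self_nonneg _) hgg] at h0
    filter_upwards [h0, hΦg] with z h1 h2
    rw [h2, mul_self_eq_zero.1 h1]
    ring
  refine ⟨m, fun z hz => ?_⟩
  by_contra hne
  -- From almost everywhere to everywhere: every neighbourhood of a point of the support has
  -- positive measure, so by continuity `Φ` cannot differ from `m` there.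
  have hnear : ∀ᶠ w in 𝓝[K] z, Φ w ≠ m := (hc z hz).eventually_ne hne
  obtain ⟨U, hU, hUK⟩ := mem_nhdsWithin_iff_exists_mem_nhds_inter.1 hnear
  have hpos : 0 < μ U := (Measure.mem_support_iff_forall z).1 (hsupp ▸ hz) U hU
  refine hpos.ne' (measure_mono_null (fun w hw => ?_) (hae.and hKae))
  intro h
  exact hUK ⟨hw, h.2⟩ h.1

/-! ### The droplet measure of an algebraic potential -/

lemma laplacian_norm_sq (z : ℂ) : Laplacian.laplacian (fun w : ℂ => ‖w‖ ^ 2) z = 4 := by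
  have h1 : fderiv ℝ (fun w : ℂ => ‖w‖ ^ 2) = fun w => (2 : ℝ) • innerSL ℝ w := by
    ext1 w
    have := (hasStrictFDerivAt_norm_sq w).hasFDerivAt.fderiv
    rw [this]
    ext v; simp; ring
  rw [InnerProductSpace.laplacian_eq_iteratedFDeriv_complexPlane]
  simp only [iteratedFDeriv_two_apply, h1]
  have h2 : fderiv ℝ (fun w : ℂ => (2 : ℝ) • innerSL ℝ w) z = (2 : ℝ) • innerSL ℝ :=
    ((innerSL ℝ : ℂ →L[ℝ] _).hasFDerivAt.const_smul (2 : ℝ)).fderiv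
  rw [h2]
  have h3 (v : ℂ) : (innerSL ℝ : ℂ →L[ℝ] _) v v = ‖v‖ ^ 2 := by
    rw [innerSL_apply_apply, real_inner_self_eq_norm_sq]
  simp [h3]
  norm_num

/-- The polynomial `∑ s_j z^j / j`; twice its real part is added to `H`. -/
def perturbPoly {J : Finset ℕ} (s : J → ℂ) (z : ℂ) : ℂ :=
  ∑ j : J, s j / ((j : ℕ) : ℂ) * z ^ (j : ℕ)

lemma analyticAt_perturbPoly {J : Finset ℕ} (s : J → ℂ) (z : ℂ) :
    AnalyticAt ℂ (perturbPoly s) z := by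
  unfold perturbPoly
  fun_prop

lemma potentialAt_eq (H : ℂ → ℝ) {J : Finset ℕ} (p : Times J) :
    potentialAt H p = (1 / p.1) • ((fun z => ‖z‖ ^ 2) -
      (H + (2 : ℝ) • fun z => (perturbPoly p.2 z).re)) := by
  ext z
  simp [potentialAt, potential, perturb, perturbPoly]

lemma laplacian_potentialAt {H : ℂ → ℝ} {J : Finset ℕ} (p : Times J) {z : ℂ}
    (hz : InnerProductSpace.HarmonicAt H z) :
    Laplacian.laplacian (potentialAt H p) z = 4 / p.1 := by
  have hh := hz.add ((analyticAt_perturbPoly p.2 z).harmonicAt_re.const_smul (c := (2 : ℝ)))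
  have hn : ContDiffAt ℝ 2 (fun w : ℂ => ‖w‖ ^ 2) z := (contDiff_norm_sq ℝ).contDiffAt
  have h0 : Laplacian.laplacian (H + (2 : ℝ) • fun z => (perturbPoly p.2 z).re) z = 0 :=
    hh.2.self_of_nhds
  have hd : ContDiffAt ℝ 2 ((fun w : ℂ => ‖w‖ ^ 2) -
      (H + (2 : ℝ) • fun z => (perturbPoly p.2 z).re)) z := hn.sub hh.1
  rw [potentialAt_eq, InnerProductSpace.laplacian_smul _ hd, hn.laplacian_sub hh.1,
    laplacian_norm_sq, h0]
  simp
  ring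

lemma ae_harmonicAt {H : ℂ → ℝ} (hH : IsAlgebraic H) :
    ∀ᵐ z ∂area, InnerProductSpace.HarmonicAt H z := by
  obtain ⟨num, den, hden, -, h⟩ := hH
  have hfin : {z : ℂ | den.eval z = 0}.Finite := by
    simpa [Polynomial.IsRoot] using Polynomial.finite_setOfPred_isRoot hden
  have : ∀ᵐ z ∂area, z ∉ {z : ℂ | den.eval z = 0} :=
    measure_eq_zero_iff_ae_notMem.1 (hfin.measure_zero area)
  filter_upwards [this] with z hz
  exact (h z hz).1

/-- Only `|z|²` contributes to the Laplacian, the other terms being harmonic off the finitely many,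
hence negligible, poles. -/
lemma dropletMeasure_potentialAt {H : ℂ → ℝ} (hH : IsAlgebraic H) {J : Finset ℕ} (p : Times J)
    (K : Set ℂ) :
    dropletMeasure (potentialAt H p) K = ENNReal.ofReal (1 / p.1) • area.restrict K := by
  rw [dropletMeasure, ← withDensity_const]
  refine withDensity_congr_ae (ae_restrict_of_ae ?_)
  filter_upwards [ae_harmonicAt hH] with z hz
  rw [laplacian_potentialAt p hz]
  congr 1
  ring


/-! ### Families of compact sets bounded by a moving curve -/

/-- Off the frontier of `A`, the space is split by the disjoint open sets `interior A` and `(closure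
A)ᶜ`, and a connected set meets only one of them. -/
lemma _root_.IsPreconnected.subset_of_disjoint_frontier {X : Type*} [TopologicalSpace X]
    {s A : Set X} (hs : IsPreconnected s) (hd : Disjoint s (frontier A))
    (hne : (s ∩ A).Nonempty) : s ⊆ A := by
  have hcover : s ⊆ interior A ∪ (closure A)ᶜ := by
    intro x hx
    by_contra h
    rw [mem_union, not_or, mem_compl_iff, not_not] at h
    exact disjoint_left.1 hd hx ⟨h.2, h.1⟩
  have hempty : s ∩ (interior A ∩ (closure A)ᶜ) = ∅ := by
    refine eq_empty_of_forall_notMem fun x hx => hx.2.2 ?_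
    exact subset_closure (interior_subset hx.2.1)
  rcases isPreconnected_iff_subset_of_disjoint.1 hs _ _ isOpen_interior
    isClosed_closure.isOpen_compl hcover hempty with h | h
  · exact h.trans interior_subset
  · obtain ⟨x, hx, hxA⟩ := hne
    exact absurd (subset_closure hxA) (h hx)

/-- Compact sets `K q` with connected complement and continuous area, whose boundaries are
parametrised by curves that depend smoothly on `q`. -/
structure JordanFamily {E : Type*} [NormedAddCommGroup E] [NormedSpace ℝ E]
    (V : Set E) (K : E → Set ℂ) (γ : E → ℝ → ℂ) : Prop where
  isOpen : IsOpen V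
  smooth : ContDiffOn ℝ ∞ (fun x : E × ℝ => γ x.1 x.2) (V ×ˢ (univ : Set ℝ))
  isCompact : ∀ q ∈ V, IsCompact (K q)
  isConnected_compl : ∀ q ∈ V, IsConnected (K q)ᶜ
  frontier_eq : ∀ q ∈ V, frontier (K q) = γ q '' Icc 0 1
  continuousOn_area : ContinuousOn (fun q => area (K q)) V

lemma area_closedBall (z : ℂ) {r : ℝ} (hr : 0 ≤ r) :
    area (Metric.closedBall z r) = ENNReal.ofReal (r ^ 2) := by
  rw [area, Measure.smul_apply, Complex.volume_closedBall, smul_eq_mul, ← ENNReal.ofReal_pow hr,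
    ← ENNReal.ofReal_coe_nnreal, ← ENNReal.ofReal_mul (by positivity),
    ← ENNReal.ofReal_mul (by positivity)]
  congr 1
  rw [NNReal.coe_real_pi]
  field_simp

/-- A tube of radius `ρ` around a Lipschitz curve has area `O(ρ)`. -/
lemma area_tube_le {c : ℝ → ℂ} {L : ℝ} (hL : 0 ≤ L)
    (hc : ∀ x ∈ Icc (0 : ℝ) 1, ∀ y ∈ Icc (0 : ℝ) 1, ‖c x - c y‖ ≤ L * |x - y|)
    {ρ : ℝ} (hρ : 0 < ρ) (hρ1 : ρ ≤ 1) :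
    area {z | ∃ θ ∈ Icc (0 : ℝ) 1, ‖z - c θ‖ ≤ ρ} ≤ ENNReal.ofReal (3 * (1 + L) ^ 2 * ρ) := by
  set N := ⌈1 / ρ⌉₊ with hN
  have hN1 : 1 / ρ ≤ N := Nat.le_ceil _
  have hN2 : (N : ℝ) < 1 / ρ + 1 := Nat.ceil_lt_add_one (by positivity)
  have hNpos : (0 : ℝ) < N := lt_of_lt_of_le (by positivity) hN1
  -- The mesh `1 / N` is at most `ρ`, so moving from `θ` to the grid point below it displaces the
  -- curve by at most `L ρ`.
  have hsub : {z | ∃ θ ∈ Icc (0 : ℝ) 1, ‖z - c θ‖ ≤ ρ} ⊆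
      ⋃ i ∈ Finset.range (N + 1), Metric.closedBall (c (i / N)) ((1 + L) * ρ) := by
    rintro z ⟨θ, hθ, hz⟩
    have hfl : (⌊θ * N⌋₊ : ℝ) ≤ θ * N := Nat.floor_le (mul_nonneg hθ.1 hNpos.le)
    have hfl2 : θ * N < ⌊θ * N⌋₊ + 1 := Nat.lt_floor_add_one _
    have hle : (⌊θ * N⌋₊ : ℝ) ≤ N := hfl.trans (by nlinarith [hθ.2])
    refine mem_biUnion (x := ⌊θ * N⌋₊) ?_ ?_
    · simp only [Finset.coe_range, mem_Iio]
      have : ⌊θ * N⌋₊ ≤ N := by exact_mod_cast hle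
      omega
    · rw [mem_closedBall_iff_norm]
      have hmem : (⌊θ * N⌋₊ : ℝ) / N ∈ Icc (0 : ℝ) 1 :=
        ⟨by positivity, (div_le_one hNpos).2 hle⟩
      have hd : |θ - ⌊θ * N⌋₊ / N| ≤ ρ := by
        have h1 : θ - ⌊θ * N⌋₊ / N = (θ * N - ⌊θ * N⌋₊) / N := by field_simp
        rw [h1, abs_of_nonneg (div_nonneg (by linarith) hNpos.le), div_le_iff₀ hNpos]
        rw [div_le_iff₀ hρ] at hN1
        linarith
      calc ‖z - c (⌊θ * N⌋₊ / N)‖ = ‖(z - c θ) + (c θ - c (⌊θ * N⌋₊ / N))‖ := by congr 1; ring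
        _ ≤ ‖z - c θ‖ + ‖c θ - c (⌊θ * N⌋₊ / N)‖ := norm_add_le _ _
        _ ≤ ρ + L * ρ := add_le_add hz ((hc θ hθ _ hmem).trans (by gcongr))
        _ = (1 + L) * ρ := by ring
  refine (measure_mono hsub).trans ((measure_biUnion_finset_le _ _).trans ?_)
  simp_rw [area_closedBall _ (show 0 ≤ (1 + L) * ρ by positivity)]
  rw [Finset.sum_const, Finset.card_range, ← ENNReal.ofReal_nsmul]
  refine ENNReal.ofReal_le_ofReal ?_
  rw [nsmul_eq_mul]
  push_cast
  -- Indeed `(N + 1) ρ < 1 + 2ρ ≤ 3`.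
  have h3 : ((N : ℝ) + 1) * ρ ≤ 3 := by
    have : (1 / ρ) * ρ = 1 := by field_simp
    nlinarith
  calc ((N : ℝ) + 1) * ((1 + L) * ρ) ^ 2 = (((N : ℝ) + 1) * ρ) * ((1 + L) ^ 2 * ρ) := by ring
    _ ≤ 3 * ((1 + L) ^ 2 * ρ) := by gcongr
    _ = 3 * (1 + L) ^ 2 * ρ := by ring

namespace JordanFamily

variable {E : Type*} [NormedAddCommGroup E] [NormedSpace ℝ E]
  {V : Set E} {K : E → Set ℂ} {γ : E → ℝ → ℂ} {p : E}

/-- The outward radial ray from a point of `K p` outside the ball would never meet the frontier, so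
it would lie in the bounded set `K p`. -/
lemma subset_ball_of_frontier (h : JordanFamily V K γ) (hp : p ∈ V) {R : ℝ}
    (hR : frontier (K p) ⊆ Metric.ball 0 R) (hR0 : 0 < R) : K p ⊆ Metric.ball 0 R := by
  intro z hz
  by_contra hzR
  rw [mem_ball_zero_iff, not_lt] at hzR
  have hpre : IsPreconnected ((fun s : ℝ => (s : ℂ) * z) '' Ici 1) :=
    isPreconnected_Ici.image _ (by fun_prop)
  have hsub : (fun s : ℝ => (s : ℂ) * z) '' Ici 1 ⊆ K p := by
    refine hpre.subset_of_disjoint_frontier ?_ ⟨z, ⟨1, by simp, by simp⟩, hz⟩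
    rw [disjoint_left]
    rintro _ ⟨s, hs, rfl⟩ hf
    have := hR hf
    rw [mem_ball_zero_iff, norm_mul, Complex.norm_real, Real.norm_eq_abs,
      abs_of_pos (lt_of_lt_of_le one_pos hs)] at this
    nlinarith [mem_Ici.1 hs]
  obtain ⟨M, hM⟩ := (h.isCompact p hp).isBounded.exists_norm_le
  have hz0 : 0 < ‖z‖ := hR0.trans_le hzR
  have hs1 : (1 : ℝ) ≤ max 1 ((M + 1) / ‖z‖) := le_max_left _ _
  have h1 := hM _ (hsub ⟨max 1 ((M + 1) / ‖z‖), hs1, rfl⟩)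
  rw [norm_mul, Complex.norm_real, Real.norm_eq_abs, abs_of_pos (lt_of_lt_of_le one_pos hs1)] at h1
  have h2 : (M + 1) / ‖z‖ * ‖z‖ = M + 1 := by field_simp
  nlinarith [le_max_right 1 ((M + 1) / ‖z‖)]

variable [ProperSpace E]

lemma exists_lipschitz (h : JordanFamily V K γ) (hp : p ∈ V) :
    ∃ L > 0, ∃ r > 0, Metric.closedBall p r ⊆ V ∧
      ∀ q ∈ Metric.closedBall p r, ∀ q' ∈ Metric.closedBall p r,
      ∀ x ∈ Icc (0 : ℝ) 1, ∀ y ∈ Icc (0 : ℝ) 1,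
        ‖γ q x - γ q' y‖ ≤ L * max ‖q - q'‖ |x - y| := by
  obtain ⟨r, hr, hrV⟩ := Metric.nhds_basis_closedBall.mem_iff.1 (h.isOpen.mem_nhds hp)
  have hsub : Metric.closedBall p r ×ˢ Icc (0 : ℝ) 1 ⊆ V ×ˢ univ :=
    prod_mono hrV (subset_univ _)
  obtain ⟨L, hL⟩ := (h.smooth.mono hsub).exists_lipschitzOnWith (by simp)
    ((convex_closedBall p r).prod (convex_Icc 0 1))
    ((isCompact_closedBall p r).prod isCompact_Icc)
  refine ⟨L + 1, by positivity, r, hr, hrV, fun q hq q' hq' x hx y hy => ?_⟩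
  have h1 := hL.dist_le_mul (q, x) ⟨hq, hx⟩ (q', y) ⟨hq', hy⟩
  rw [dist_eq_norm, Prod.dist_eq, dist_eq_norm, Real.dist_eq] at h1
  refine h1.trans ?_
  gcongr
  linarith

lemma area_frontier (h : JordanFamily V K γ) (hp : p ∈ V) : area (frontier (K p)) = 0 := by
  obtain ⟨L, hL, r, hr, -, hlip⟩ := h.exists_lipschitz hp
  have hpr := Metric.mem_closedBall_self (x := p) hr.le
  have hc : ∀ x ∈ Icc (0 : ℝ) 1, ∀ y ∈ Icc (0 : ℝ) 1, ‖γ p x - γ p y‖ ≤ L * |x - y| := by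
    intro x hx y hy
    simpa using hlip p hpr p hpr x hx y hy
  have hle : ∀ᶠ ρ : ℝ in 𝓝[>] 0, area (frontier (K p)) ≤
      ENNReal.ofReal (3 * (1 + L) ^ 2 * ρ) := by
    filter_upwards [Ioo_mem_nhdsGT (show (0 : ℝ) < 1 by norm_num)] with ρ hρ
    refine (measure_mono ?_).trans (area_tube_le hL.le hc hρ.1 hρ.2.le)
    rw [h.frontier_eq p hp]
    rintro _ ⟨θ, hθ, rfl⟩
    exact ⟨θ, hθ, by simpa using hρ.1.le⟩
  have hlim : Tendsto (fun ρ : ℝ => ENNReal.ofReal (3 * (1 + L) ^ 2 * ρ)) (𝓝[>] 0) (𝓝 0) := by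
    have : Tendsto (fun ρ : ℝ => ENNReal.ofReal (3 * (1 + L) ^ 2 * ρ)) (𝓝 0)
        (𝓝 (ENNReal.ofReal (3 * (1 + L) ^ 2 * 0))) :=
      (ENNReal.continuous_ofReal.comp (by fun_prop)).tendsto 0
    rw [mul_zero, ENNReal.ofReal_zero] at this
    exact this.mono_left nhdsWithin_le_nhds
  exact le_antisymm (ge_of_tendsto hlim hle) zero_le

lemma eventually_subset_ball (h : JordanFamily V K γ) (hp : p ∈ V) :
    ∃ R > 0, ∀ᶠ q in 𝓝 p, K q ⊆ Metric.ball 0 R := by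
  obtain ⟨L, hL, r, hr, hrV, hlip⟩ := h.exists_lipschitz hp
  refine ⟨‖γ p 0‖ + L * max r 1 + 1, by positivity, ?_⟩
  filter_upwards [Metric.closedBall_mem_nhds p hr] with q hq
  refine h.subset_ball_of_frontier (hrV hq) ?_ (by positivity)
  rw [h.frontier_eq q (hrV hq)]
  rintro _ ⟨θ, hθ, rfl⟩
  have h1 := hlip q hq p (Metric.mem_closedBall_self hr.le) θ hθ 0 (by simp)
  have h2 : max ‖q - p‖ |θ - 0| ≤ max r 1 := by
    refine max_le_max (mem_closedBall_iff_norm.1 hq) ?_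
    rw [sub_zero, abs_of_nonneg hθ.1]
    exact hθ.2
  rw [mem_ball_zero_iff]
  calc ‖γ q θ‖ = ‖γ p 0 + (γ q θ - γ p 0)‖ := by congr 1; ring
    _ ≤ ‖γ p 0‖ + ‖γ q θ - γ p 0‖ := norm_add_le _ _
    _ ≤ ‖γ p 0‖ + L * max r 1 := by gcongr; exact h1.trans (by gcongr)
    _ < _ := by linarith

lemma eventually_disjoint_frontier (h : JordanFamily V K γ) (hp : p ∈ V) {S : Set ℂ}
    (hS : IsCompact S) (hd : Disjoint S (frontier (K p))) :
    ∀ᶠ q in 𝓝 p, Disjoint S (frontier (K q)) := by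
  obtain ⟨L, hL, r, hr, hrV, hlip⟩ := h.exists_lipschitz hp
  obtain ⟨δ, hδ, hdis⟩ := hd.exists_thickenings hS isClosed_frontier
  filter_upwards [Metric.closedBall_mem_nhds p hr, Metric.ball_mem_nhds p (div_pos hδ hL)]
    with q hq hq2
  rw [disjoint_left]
  intro z hz hzf
  rw [h.frontier_eq q (hrV hq)] at hzf
  obtain ⟨θ, hθ, rfl⟩ := hzf
  refine disjoint_left.1 hdis (Metric.self_subset_thickening hδ _ hz) ?_
  rw [Metric.mem_thickening_iff]
  refine ⟨γ p θ, by rw [h.frontier_eq p hp]; exact ⟨θ, hθ, rfl⟩, ?_⟩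
  have h1 := hlip q hq p (Metric.mem_closedBall_self hr.le) θ hθ θ hθ
  rw [sub_self, abs_zero, max_eq_left (norm_nonneg _)] at h1
  rw [dist_eq_norm]
  refine h1.trans_lt ?_
  rw [mem_ball_iff_norm, lt_div_iff₀ hL] at hq2
  linarith

/-- Points outside `K p` stay outside. -/
lemma eventually_notMem (h : JordanFamily V K γ) (hp : p ∈ V) {z₀ : ℂ} (hz₀ : z₀ ∉ K p) :
    ∀ᶠ x : E × ℂ in 𝓝 (p, z₀), x.2 ∉ K x.1 := by
  have hopen : IsOpen (K p)ᶜ := (h.isCompact p hp).isClosed.isOpen_compl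
  obtain ⟨ρ, hρ, hball⟩ := Metric.nhds_basis_closedBall.mem_iff.1 (hopen.mem_nhds hz₀)
  obtain ⟨R, hR, hKR⟩ := h.eventually_subset_ball hp
  have hw : (R : ℂ) ∉ Metric.ball (0 : ℂ) R := by
    simp [abs_of_pos hR]
  -- A path in the complement joins `z₀` to the point `R`, which stays outside every nearby `K q`.
  -- Together with a closed disc about `z₀` it forms a compact connected set off the boundary of `K
  -- p`, hence off that of `K q`, so it lies entirely outside `K q`.
  have hpath := hopen.isConnected_iff_isPathConnected.1 (h.isConnected_compl p hp)
  have hjoin := hpath.joinedIn z₀ hz₀ (R : ℂ) fun hmem => hw (hKR.self_of_nhds hmem)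
  set P := range hjoin.somePath with hP
  set S := P ∪ Metric.closedBall z₀ ρ with hS
  have hScomp : IsCompact S :=
    (isCompact_range hjoin.somePath.continuous).union (isCompact_closedBall z₀ ρ)
  have hSpre : IsPreconnected S :=
    IsPreconnected.union z₀ ⟨0, by simp⟩ (Metric.mem_closedBall_self hρ.le)
      (isPreconnected_range hjoin.somePath.continuous) (convex_closedBall z₀ ρ).isPreconnected
  have hSK : S ⊆ (K p)ᶜ :=
    union_subset (range_subset_iff.2 fun t => hjoin.somePath_mem t) hball
  have hSf : Disjoint S (frontier (K p)) := by
    refine disjoint_left.2 fun x hx hxf => hSK hx ?_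
    exact (h.isCompact p hp).isClosed.frontier_subset hxf
  have hev := h.eventually_disjoint_frontier hp hScomp hSf
  rw [nhds_prod_eq]
  filter_upwards [(hev.and hKR).prod_mk (Metric.closedBall_mem_nhds z₀ hρ)] with x hx
  obtain ⟨⟨h1, h2⟩, h3⟩ := hx
  have := hSpre.subset_of_disjoint_frontier (A := (K x.1)ᶜ) (by rwa [frontier_compl])
    ⟨R, Or.inl ⟨1, by simp⟩, fun hmem => hw (h2 hmem)⟩
  exact this (Or.inr h3)

lemma eventually_subset_of_isOpen (h : JordanFamily V K γ) (hp : p ∈ V) {O : Set ℂ}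
    (hO : IsOpen O) (hKO : K p ⊆ O) : ∀ᶠ q in 𝓝 p, K q ⊆ O := by
  obtain ⟨R, hR, hKR⟩ := h.eventually_subset_ball hp
  have hcomp : IsCompact (Metric.closedBall (0 : ℂ) R \ O) :=
    (isCompact_closedBall 0 R).diff hO
  have hev := hcomp.eventually_forall_of_forall_eventually (x₀ := p)
    (P := fun q z => z ∉ K q) fun z hz => h.eventually_notMem hp fun hzK => hz.2 (hKO hzK)
  filter_upwards [hKR, hev] with q h1 h2 z hz
  by_contra hzO
  exact h2 z ⟨Metric.ball_subset_closedBall (h1 hz), hzO⟩ hz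

/-- Balls inside `K p` stay inside, because the area varies continuously. -/
lemma eventually_closedBall_subset (h : JordanFamily V K γ) (hp : p ∈ V) {z₀ : ℂ} {ρ : ℝ}
    (hρ : 0 < ρ) (hsub : Metric.closedBall z₀ ρ ⊆ interior (K p)) :
    ∀ᶠ q in 𝓝 p, Metric.closedBall z₀ ρ ⊆ K q := by
  set B := Metric.closedBall z₀ ρ with hB
  have hBf : Disjoint B (frontier (K p)) :=
    disjoint_left.2 fun x hx hxf => hxf.2 (hsub hx)
  have hBarea : area B = ENNReal.ofReal (ρ ^ 2) := area_closedBall z₀ hρ.le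
  have hfin : area (K p) ≠ ⊤ := (h.isCompact p hp).measure_lt_top.ne
  -- Here `η` is half the area of the disc `B`. If `K q` missed `B`, it would lie in `O \ B` with
  -- `area O < area (K p) + η`, so its area would be below `area (K p) - η`, against continuity of
  -- the area.
  set η := ENNReal.ofReal (ρ ^ 2 / 2) with hη
  have hη0 : η ≠ 0 := by
    rw [hη, Ne, ENNReal.ofReal_eq_zero, not_le]
    positivity
  obtain ⟨O, hKO, hO, hOlt⟩ := exists_isOpen_lt_add (K p) hfin hη0
  have hBη : area B = η + η := by
    rw [hBarea, hη, ← ENNReal.ofReal_add (by positivity) (by positivity)]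
    congr 1
    ring
  have hBle : area B ≤ area (K p) := measure_mono (hsub.trans interior_subset)
  have hlow : area (K p) - η < area (K p) := by
    refine ENNReal.sub_lt_self hfin ?_ hη0
    intro h0
    rw [h0, hBη] at hBle
    exact hη0 (by simpa using hBle)
  have hcont : ContinuousAt (fun q => area (K q)) p :=
    h.continuousOn_area.continuousAt (h.isOpen.mem_nhds hp)
  filter_upwards [h.eventually_disjoint_frontier hp (isCompact_closedBall z₀ ρ) hBf,
    h.eventually_subset_of_isOpen hp hO hKO, hcont.eventually_const_lt hlow] with q h1 h2 h3
  refine (convex_closedBall z₀ ρ).isPreconnected.subset_of_disjoint_frontier h1 ?_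
  by_contra hne
  rw [not_nonempty_iff_eq_empty] at hne
  have hKq : K q ⊆ O \ B := fun z hz => ⟨h2 hz, fun hzB => by
    have : z ∈ B ∩ K q := ⟨hzB, hz⟩
    rw [hne] at this
    exact this⟩
  have h4 : area (K q) + area B ≤ area O := by
    rw [← measure_union (disjoint_left.2 fun z hz hzB => (hKq hz).2 hzB)
      Metric.isClosed_closedBall.measurableSet]
    exact measure_mono (union_subset h2 ((hsub.trans interior_subset).trans hKO))
  have hηfin : η ≠ ⊤ := ENNReal.ofReal_ne_top
  have h5 : area (K p) < area (K q) + η :=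
    (ENNReal.sub_lt_iff_lt_right hηfin (le_trans (by rw [hBη]; exact le_self_add) hBle)).1 h3
  have h6 : area (K q) + area B < area (K q) + area B := by
    calc area (K q) + area B ≤ area O := h4
      _ < area (K p) + η := hOlt
      _ ≤ (area (K q) + η) + η := by gcongr
      _ = area (K q) + area B := by rw [hBη, add_assoc]
  exact lt_irrefl _ h6

lemma eventually_mem_iff (h : JordanFamily V K γ) (hp : p ∈ V) {z : ℂ}
    (hz : z ∉ frontier (K p)) : ∀ᶠ q in 𝓝 p, (z ∈ K p ↔ z ∈ K q) := by
  by_cases hzK : z ∈ K p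
  · rw [(h.isCompact p hp).isClosed.frontier_eq, Set.mem_sdiff, not_and_not_right] at hz
    obtain ⟨ρ, hρ, hball⟩ :=
      Metric.nhds_basis_closedBall.mem_iff.1 (isOpen_interior.mem_nhds (hz hzK))
    filter_upwards [h.eventually_closedBall_subset hp hρ hball] with q hq
    exact ⟨fun _ => hq (Metric.mem_closedBall_self hρ.le), fun _ => hzK⟩
  · have := (h.eventually_notMem hp hzK)
    rw [nhds_prod_eq] at this
    filter_upwards [this.curry] with q hq
    exact ⟨fun h' => absurd h' hzK, fun h' => absurd h' hq.self_of_nhds⟩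

/-- The area of `K q ∆ K p` is `O(‖q - p‖)`. -/
lemma eventually_area_symmDiff_le (h : JordanFamily V K γ) (hp : p ∈ V) :
    ∃ C ≥ 0, ∀ᶠ q in 𝓝 p, area (symmDiff (K q) (K p)) ≤ ENNReal.ofReal (C * ‖q - p‖) := by
  obtain ⟨L, hL, r, hr, hrV, hlip⟩ := h.exists_lipschitz hp
  have hpr := Metric.mem_closedBall_self (x := p) hr.le
  refine ⟨3 * (1 + L) ^ 2 * L, by positivity, ?_⟩
  filter_upwards [Metric.closedBall_mem_nhds p hr,
    Metric.ball_mem_nhds p (div_pos one_pos hL)] with q hq hq2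
  rcases eq_or_ne q p with rfl | hne
  · simp
  have hpos : 0 < ‖q - p‖ := norm_pos_iff.2 (sub_ne_zero.2 hne)
  have hρ1 : L * ‖q - p‖ ≤ 1 := by
    rw [mem_ball_iff_norm, lt_div_iff₀ hL] at hq2
    linarith
  have hc : ∀ x ∈ Icc (0 : ℝ) 1, ∀ y ∈ Icc (0 : ℝ) 1, ‖γ p x - γ p y‖ ≤ L * |x - y| := by
    intro x hx y hy
    simpa using hlip p hpr p hpr x hx y hy
  refine (measure_mono ?_).trans
    ((area_tube_le hL.le hc (mul_pos hL hpos) hρ1).trans (by rw [mul_assoc _ L]))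
  intro z hz
  by_contra hfar
  simp only [mem_ofPred_eq, not_exists, not_and, not_le] at hfar
  have hsubr : Metric.closedBall p ‖q - p‖ ⊆ Metric.closedBall p r :=
    Metric.closedBall_subset_closedBall (mem_closedBall_iff_norm.1 hq)
  -- For every `x` in the closed ball of radius `‖q - p‖` about `p`, the curve of `x` stays within
  -- `L ‖q - p‖` of that of `p` and so misses `z`. Membership of `z` in `K x` is thus locally
  -- constant on a connected ball.
  have hconst : z ∈ K p ↔ z ∈ K q := by
    refine (convex_closedBall p ‖q - p‖).isPreconnected.induction₂
      (fun x y => (z ∈ K x ↔ z ∈ K y)) ?_ (fun x y w _ _ _ h1 h2 => h1.trans h2)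
      (fun x y _ _ h1 => h1.symm) (Metric.mem_closedBall_self (norm_nonneg _))
      (mem_closedBall_iff_norm.2 le_rfl)
    intro x hx
    refine (h.eventually_mem_iff (hrV (hsubr hx)) ?_).filter_mono nhdsWithin_le_nhds
    rw [h.frontier_eq x (hrV (hsubr hx))]
    rintro ⟨θ, hθ, rfl⟩
    refine absurd (hfar θ hθ) (not_lt.2 ?_)
    have h1 := hlip x (hsubr hx) p hpr θ hθ θ hθ
    rw [sub_self, abs_zero, max_eq_left (norm_nonneg _)] at h1
    exact h1.trans (by gcongr; exact mem_closedBall_iff_norm.1 hx)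
  rcases hz with hz | hz
  · exact hz.2 (hconst.2 hz.1)
  · exact hz.2 (hconst.1 hz.1)

end JordanFamily


/-! ### Droplets: area, Robin constant, energy -/

/-- `t₀ Q`, which does not depend on `t₀`. -/
def reducedPotential (H : ℂ → ℝ) {J : Finset ℕ} (s : J → ℂ) (z : ℂ) : ℝ :=
  ‖z‖ ^ 2 - perturb H s z

lemma mul_potentialAt (H : ℂ → ℝ) {J : Finset ℕ} {p : Times J} (hp : 0 < p.1) (z : ℂ) :
    p.1 * potentialAt H p z = reducedPotential H p.2 z := by
  simp only [potentialAt, potential, reducedPotential]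
  field_simp

lemma continuous_perturbPoly {J : Finset ℕ} (s : J → ℂ) : Continuous (perturbPoly s) := by
  unfold perturbPoly
  fun_prop

lemma reducedPotential_eq (H : ℂ → ℝ) {J : Finset ℕ} (s : J → ℂ) (z : ℂ) :
    reducedPotential H s z = ‖z‖ ^ 2 - H z - 2 * (perturbPoly s z).re := by
  simp only [reducedPotential, perturb, perturbPoly]
  ring

section Droplet

variable {H : ℂ → ℝ} {J : Finset ℕ} {p : Times J} {S K : Set ℂ}

lemma continuousAt_of_isDroplet (hp : 0 < p.1) (hK : IsDroplet (potentialAt H p) S K) {z : ℂ}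
    (hz : z ∈ K) : ContinuousAt H z := by
  have h1 : ContinuousAt (potentialAt H p) z := (hK.2.1 z hz).continuousAt
  have h2 : H = fun w => ‖w‖ ^ 2 - 2 * (perturbPoly p.2 w).re - p.1 * potentialAt H p w := by
    ext w
    rw [mul_potentialAt H hp, reducedPotential_eq]
    ring
  rw [h2]
  have := (continuous_perturbPoly p.2).continuousAt (x := z)
  fun_prop

lemma area_of_isDroplet (hH : IsAlgebraic H) (hp : 0 < p.1)
    (hK : IsDroplet (potentialAt H p) S K) : area K = ENNReal.ofReal p.1 := by
  have h := hK.2.2.1.1.measure_univ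
  rw [dropletMeasure_potentialAt hH, Measure.smul_apply, Measure.restrict_apply_univ, smul_eq_mul,
    one_div, ENNReal.ofReal_inv_of_pos hp] at h
  have h0 : ENNReal.ofReal p.1 ≠ 0 := by simpa using hp
  have h1 := congrArg (ENNReal.ofReal p.1 * ·) h
  simpa only [← mul_assoc, ENNReal.mul_inv_cancel h0 ENNReal.ofReal_ne_top, one_mul, mul_one]
    using h1

lemma log_one_div (x : ℝ) : Real.log (1 / x) = -Real.log x := by
  rw [one_div, Real.log_inv]

lemma robin_of_isDroplet (hH : IsAlgebraic H) (hp : 0 < p.1)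
    (hK : IsDroplet (potentialAt H p) S K) (hf : area (frontier K) = 0) :
    ∃ C : ℝ, ∀ z ∈ K, -2 * logPot K z + reducedPotential H p.2 z = C := by
  have hint : ∀ z, 2 * ∫ ζ, Real.log (1 / ‖z - ζ‖) ∂(dropletMeasure (potentialAt H p) K) +
      potentialAt H p z = 1 / p.1 * (-2 * logPot K z + reducedPotential H p.2 z) := by
    intro z
    rw [← mul_potentialAt H hp, dropletMeasure_potentialAt hH, integral_smul_measure, logPot,
      ENNReal.toReal_ofReal (by positivity)]
    simp_rw [log_one_div, integral_neg, smul_eq_mul]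
    field_simp
  have hc : ContinuousOn (fun z => -2 * logPot K z + reducedPotential H p.2 z) K := by
    intro z hz
    have h1 := continuousAt_of_isDroplet hp hK hz
    have h2 := (continuous_logPot hK.1 hf).continuousAt (x := z)
    have h3 := (continuous_perturbPoly p.2).continuousAt (x := z)
    simp_rw [reducedPotential_eq]
    exact ContinuousAt.continuousWithinAt (by fun_prop)
  obtain ⟨C, hC⟩ := isEquilibriumMeasure_const_on_support hK.2.2.1 hK.1 hK.2.2.2 <| by
    simp_rw [hint]
    exact continuousOn_const.mul hc
  refine ⟨p.1 * C, fun z hz => ?_⟩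
  rw [← hC z hz, hint]
  field_simp

lemma isRobinConstant_of_eq {C : ℝ} (hp : 0 < p.1)
    (hC : ∀ z ∈ K, -2 * logPot K z + reducedPotential H p.2 z = C) :
    IsRobinConstant p.1 (potentialAt H p) K C := by
  intro z hz
  rw [← hC z hz, mul_potentialAt H hp, logPot]
  simp_rw [log_one_div, Real.log_pow, integral_neg, integral_const_mul]
  push_cast
  ring

lemma logTau_potentialAt (hp : 0 < p.1) :
    logTau p.1 (potentialAt H p) K =
      (∫ z in K, logPot K z ∂area) - ∫ z in K, reducedPotential H p.2 z ∂area := by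
  simp_rw [logTau, log_one_div, integral_neg, neg_neg, ← mul_potentialAt H hp,
    integral_const_mul, logPot]

/-- Two minimisers have equal energy, so `μ` can be replaced by the droplet measure without knowing
that the equilibrium measure is unique. -/
lemma logTau_eq_energy (hH : IsAlgebraic H) (hp : 0 < p.1)
    (hK : IsDroplet (potentialAt H p) univ K) {μ : Measure ℂ}
    (hμ : IsEquilibriumMeasure (potentialAt H p) univ μ) :
    logTau p.1 (potentialAt H p) K = -p.1 ^ 2 * energy (potentialAt H p) μ := by
  have heq : energy (potentialAt H p) μ =
      energy (potentialAt H p) (dropletMeasure (potentialAt H p) K) := by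
    obtain ⟨h1, h2, h3, h4⟩ := hμ
    obtain ⟨h1', h2', h3', h4'⟩ := hK.2.2.1
    exact le_antisymm (h4 _ h1' h2' h3') (h4' _ h1 h2 h3)
  obtain ⟨hprob, -, ⟨-, hL, -⟩, -⟩ := hK.2.2.1
  rw [heq, energy, integral_prod _ hL, dropletMeasure_potentialAt hH, integral_smul_measure,
    integral_smul_measure, logTau, ENNReal.toReal_ofReal (by positivity)]
  simp_rw [integral_smul_measure, ENNReal.toReal_ofReal (show 0 ≤ 1 / p.1 by positivity),
    smul_eq_mul, integral_const_mul]
  field_simp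
  ring

end Droplet

lemma IsSmoothDropletFamily.isDroplet {H : ℂ → ℝ} {J : Finset ℕ} {V : Set (Times J)}
    {K : Times J → Set ℂ} (hK : IsSmoothDropletFamily H V K) {q : Times J} (hq : q ∈ V) :
    ∃ S, IsDroplet (potentialAt H q) S (K q) :=
  let ⟨U, _, _, h⟩ := (hK.1 q hq).2.1
  ⟨closure U, h⟩

lemma IsSmoothDropletFamily.area_eq {H : ℂ → ℝ} (hH : IsAlgebraic H) {J : Finset ℕ}
    {V : Set (Times J)} {K : Times J → Set ℂ} (hK : IsSmoothDropletFamily H V K) {q : Times J}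
    (hq : q ∈ V) : area (K q) = ENNReal.ofReal q.1 :=
  let ⟨_, h⟩ := hK.isDroplet hq
  area_of_isDroplet hH (hK.1 q hq).1 h

lemma IsSmoothDropletFamily.continuousAt {H : ℂ → ℝ} {J : Finset ℕ}
    {V : Set (Times J)} {K : Times J → Set ℂ} (hK : IsSmoothDropletFamily H V K) {q : Times J}
    (hq : q ∈ V) {z : ℂ} (hz : z ∈ K q) : ContinuousAt H z :=
  let ⟨_, h⟩ := hK.isDroplet hq
  continuousAt_of_isDroplet (hK.1 q hq).1 h hz

/-- Continuity of the area is immediate, since the area of the droplet is the time `t₀` itself. -/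
lemma IsSmoothDropletFamily.exists_jordanFamily {H : ℂ → ℝ} (hH : IsAlgebraic H) {J : Finset ℕ}
    {V : Set (Times J)} (hV : IsOpen V) {K : Times J → Set ℂ}
    (hK : IsSmoothDropletFamily H V K) : ∃ γ, JordanFamily V K γ := by
  obtain ⟨γ, hγ, h⟩ := hK.2
  refine ⟨γ, hV, hγ, fun q hq => (hK.1 q hq).2.2.1, fun q hq => (hK.1 q hq).2.2.2.2,
    fun q hq => ?_, ?_⟩
  · have := (h q hq).1.image_Icc one_pos 0
    rw [zero_add] at this
    rw [this, (h q hq).2.2.2]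
  · have : ContinuousOn (fun q : Times J => ENNReal.ofReal q.1) V :=
      (ENNReal.continuous_ofReal.comp continuous_fst).continuousOn
    exact this.congr fun q hq => hK.area_eq hH hq

/-! ### The derivative of the tau-function -/

lemma norm_setIntegral_sub_setIntegral_le {F : Type*} [NormedAddCommGroup F] [NormedSpace ℝ F]
    {m : Measure ℂ} {A B : Set ℂ} (hA : MeasurableSet A) (hB : MeasurableSet B) {f : ℂ → F}
    (hfA : IntegrableOn f A m) (hfB : IntegrableOn f B m) :
    ‖∫ z in A, f z ∂m - ∫ z in B, f z ∂m‖ ≤ ∫ z in symmDiff A B, ‖f z‖ ∂m := by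
  have h1 := integral_inter_add_sdiff (f := f) (μ := m) (s := A) hB hfA
  have h2 := integral_inter_add_sdiff (f := f) (μ := m) (s := B) hA hfB
  rw [inter_comm] at h2
  have hd : Disjoint (A \ B) (B \ A) := disjoint_left.2 fun x hx hx' => hx.2 hx'.1
  rw [Set.symmDiff_def, setIntegral_union hd (hB.diff hA)
    (hfA.mono_set sdiff_subset).norm (hfB.mono_set sdiff_subset).norm, ← h1, ← h2,
    add_sub_add_left_eq_sub]
  exact (norm_sub_le _ _).trans
    (add_le_add (norm_integral_le_integral_norm _) (norm_integral_le_integral_norm _))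

lemma norm_setIntegral_sub_setIntegral_le_const {F : Type*} [NormedAddCommGroup F]
    [NormedSpace ℝ F]
    {m : Measure ℂ} {A B : Set ℂ} (hA : MeasurableSet A) (hB : MeasurableSet B) {f : ℂ → F}
    (hfA : IntegrableOn f A m) (hfB : IntegrableOn f B m) {c : ℝ}
    (hfin : m (symmDiff A B) < ⊤) (hc : ∀ z ∈ symmDiff A B, ‖f z‖ ≤ c) :
    ‖∫ z in A, f z ∂m - ∫ z in B, f z ∂m‖ ≤ c * m.real (symmDiff A B) := by
  refine (norm_setIntegral_sub_setIntegral_le hA hB hfA hfB).trans ?_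
  refine (le_abs_self _).trans ?_
  rw [← Real.norm_eq_abs]
  exact norm_setIntegral_le_of_norm_le_const hfin fun z hz => by simpa using hc z hz

lemma abs_logPot_sub_le {A B : Set ℂ} (hA : IsCompact A) (hB : IsCompact B) (z : ℂ) :
    |logPot A z - logPot B z| ≤ ∫ ζ in symmDiff A B, |Real.log ‖z - ζ‖| ∂area :=
  norm_setIntegral_sub_setIntegral_le hA.measurableSet hB.measurableSet
    (integrableOn_log_sub hA.isBounded z) (integrableOn_log_sub hB.isBounded z)

/-- The expansion of the energy functional around the set `B`. -/
lemma functional_sub_eq {A B : Set ℂ} (hA : IsCompact A) (hB : IsCompact B) {W W' : ℂ → ℝ}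
    (hWA : IntegrableOn W A area) (hWB : IntegrableOn W B area) (hWA' : IntegrableOn W' A area) (C : ℝ) :
    ((∫ z in A, logPot A z ∂area) - ∫ z in A, W' z ∂area) -
      ((∫ z in B, logPot B z ∂area) - ∫ z in B, W z ∂area) =
    ((∫ z in A, (logPot A z - logPot B z) ∂area) - ∫ z in B, (logPot A z - logPot B z) ∂area)
      - ((∫ z in A, (-2 * logPot B z + W z - C) ∂area) -
          ∫ z in B, (-2 * logPot B z + W z - C) ∂area)
      - C * (area.real A - area.real B) - ∫ z in A, (W' z - W z) ∂area := by
  obtain ⟨R, hR⟩ := (hA.isBounded.union hB.isBounded).subset_ball 0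
  obtain ⟨hRA, hRB⟩ := union_subset_iff.1 hR
  have iAA := integrableOn_logPot hRA hRA hA.measurableSet
  have iAB := integrableOn_logPot hRA hRB hA.measurableSet
  have iBA := integrableOn_logPot hRB hRA hB.measurableSet
  have iBB := integrableOn_logPot hRB hRB hB.measurableSet
  have cA : IntegrableOn (fun _ : ℂ => C) A area := integrableOn_const hA.measure_lt_top.ne
  have cB : IntegrableOn (fun _ : ℂ => C) B area := integrableOn_const hB.measure_lt_top.ne
  have fA : IntegrableOn (fun z => -2 * logPot B z + W z) A area := (iAB.const_mul _).add hWA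
  have fB : IntegrableOn (fun z => -2 * logPot B z + W z) B area := (iBB.const_mul _).add hWB
  -- The symmetry `∫_A L_B = ∫_B L_A` is the only input beyond linearity.
  have hcomm := setIntegral_logPot_comm hRA hRB hA.measurableSet
  rw [integral_sub iAA iAB, integral_sub iBA iBB, integral_sub fA cA, integral_sub fB cB,
    integral_add (iAB.const_mul _) hWA, integral_add (iBB.const_mul _) hWB,
    integral_sub hWA' hWA, integral_const_mul, integral_const_mul, setIntegral_const,
    setIntegral_const, smul_eq_mul, smul_eq_mul, hcomm]
  ring

/-- The differential of `log τ`. -/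
def dLogTau {J : Finset ℕ} (K : Set ℂ) (C : ℝ) : Times J →L[ℝ] ℝ :=
  (-C) • ContinuousLinearMap.fst ℝ ℝ (J → ℂ) + ∑ j : J, (2 : ℝ) • Complex.reCLM.comp
    ((ContinuousLinearMap.mul ℝ ℂ (interiorMoment K j / ((j : ℕ) : ℂ))).comp
      ((ContinuousLinearMap.proj j).comp (ContinuousLinearMap.snd ℝ ℝ (J → ℂ))))

lemma dLogTau_apply {J : Finset ℕ} (K : Set ℂ) (C : ℝ) (q : Times J) :
    dLogTau K C q = -C * q.1 +
      ∑ j : J, 2 * (interiorMoment K j / ((j : ℕ) : ℂ) * q.2 j).re := by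
  simp [dLogTau]

lemma setIntegral_reducedPotential_sub {H : ℂ → ℝ} {J : Finset ℕ} (s s' : J → ℂ) {A : Set ℂ}
    (hA : IsCompact A) :
    ∫ z in A, (reducedPotential H s' z - reducedPotential H s z) ∂area =
      -∑ j : J, 2 * (interiorMoment A j / ((j : ℕ) : ℂ) * (s' j - s j)).re := by
  have h1 : ∀ z, reducedPotential H s' z - reducedPotential H s z =
      -∑ j : J, 2 * ((s' j - s j) / ((j : ℕ) : ℂ) * z ^ (j : ℕ)).re := by
    intro z
    rw [reducedPotential_eq, reducedPotential_eq, perturbPoly, perturbPoly, Complex.re_sum,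
      Complex.re_sum, ← Finset.mul_sum]
    simp_rw [sub_div, sub_mul, Complex.sub_re]
    rw [Finset.sum_sub_distrib]
    ring
  simp_rw [h1]
  have hi : ∀ j : J, IntegrableOn
      (fun z : ℂ => (s' j - s j) / ((j : ℕ) : ℂ) * z ^ (j : ℕ)) A area := fun j =>
    (Continuous.continuousOn (by fun_prop)).integrableOn_compact hA
  rw [integral_neg, integral_finsetSum (f := fun (j : J) (z : ℂ) =>
    2 * ((s' j - s j) / ((j : ℕ) : ℂ) * z ^ (j : ℕ)).re) _ fun j _ => (hi j).re.const_mul 2]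
  congr 1
  refine Finset.sum_congr rfl fun j _ => ?_
  rw [integral_const_mul]
  congr 1
  have := integral_re (hi j)
  simp only [RCLike.re_to_complex] at this
  rw [this, integral_const_mul, interiorMoment]
  congr 1
  ring

/-- The Robin equation is used at `p` only; of the neighbouring droplets, only their area, the
continuity of `H` on them and their closeness to `K p` enter. The error splits into three parts,
each at most `c / 3 * ‖q - p‖`. -/
lemma hasFDerivAt_logTauAt {H : ℂ → ℝ} (hH : IsAlgebraic H) {J : Finset ℕ}
    {V : Set (Times J)} (hV : IsOpen V) {K : Times J → Set ℂ}
    (hK : IsSmoothDropletFamily H V K) {p : Times J} (hp : p ∈ V) {C : ℝ}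
    (hC : ∀ z ∈ K p, -2 * logPot (K p) z + reducedPotential H p.2 z = C) :
    HasFDerivAt (logTauAt H K) (dLogTau (K p) C) p := by
  obtain ⟨γ, hγ⟩ := hK.exists_jordanFamily hH hV
  obtain ⟨R, hR, hKR⟩ := hγ.eventually_subset_ball hp
  obtain ⟨C₀, hC₀, harea⟩ := hγ.eventually_area_symmDiff_le hp
  have hVp : ∀ᶠ q in 𝓝 p, q ∈ V := hV.mem_nhds hp
  have hWint : ∀ q ∈ V, ∀ s : J → ℂ, IntegrableOn (reducedPotential H s) (K q) area := by
    intro q hq s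
    refine ContinuousOn.integrableOn_compact (hγ.isCompact q hq) fun z hz => ?_
    have h1 := hK.continuousAt hq hz
    have h3 := (continuous_perturbPoly s).continuousAt (x := z)
    have h4 : reducedPotential H s = fun z => ‖z‖ ^ 2 - H z - 2 * (perturbPoly s z).re :=
      funext (reducedPotential_eq H s)
    rw [h4]
    exact ContinuousAt.continuousWithinAt (by fun_prop)
  have hcontΦ : ∀ z ∈ K p,
      ContinuousAt (fun z => -2 * logPot (K p) z + reducedPotential H p.2 z) z := by
    intro z hz
    have h1 := hK.continuousAt hp hz
    have h2 := (continuous_logPot (hγ.isCompact p hp) (hγ.area_frontier hp)).continuousAt (x := z)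
    have h3 := (continuous_perturbPoly p.2).continuousAt (x := z)
    simp_rw [reducedPotential_eq]
    fun_prop
  have hreal : ∀ᶠ q in 𝓝 p, area.real (symmDiff (K q) (K p)) ≤ C₀ * ‖q - p‖ := by
    filter_upwards [harea] with q hq
    exact ENNReal.toReal_le_of_le_ofReal (by positivity) hq
  have hnorm0 : Tendsto (fun q : Times J => ‖q - p‖) (𝓝 p) (𝓝 0) := by
    have : Tendsto (fun q : Times J => ‖q - p‖) (𝓝 p) (𝓝 ‖p - p‖) :=
      Continuous.tendsto (by fun_prop) p
    simpa using this
  have harea0 : Tendsto (fun q => area (symmDiff (K q) (K p))) (𝓝 p) (𝓝 0) := by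
    refine tendsto_of_tendsto_of_tendsto_of_le_of_le' tendsto_const_nhds
      (h := fun q => ENNReal.ofReal (C₀ * ‖q - p‖)) ?_
      (Eventually.of_forall fun _ => zero_le) harea
    have := (ENNReal.continuous_ofReal.tendsto (C₀ * 0)).comp (hnorm0.const_mul C₀)
    simpa [Function.comp_def] using this
  have hsymm_sub : ∀ q, K q ⊆ Metric.ball 0 R → symmDiff (K q) (K p) ⊆ Metric.ball 0 R :=
    fun q hq => (symmDiff_subset_union).trans (union_subset hq hKR.self_of_nhds)
  have hmoment : ∀ j : J, Tendsto (fun q => interiorMoment (K q) j) (𝓝 p)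
      (𝓝 (interiorMoment (K p) j)) := by
    intro j
    rw [tendsto_iff_norm_sub_tendsto_zero]
    refine squeeze_zero' (g := fun q => R ^ (j : ℕ) * (C₀ * ‖q - p‖))
      (Eventually.of_forall fun _ => norm_nonneg _) ?_ ?_
    · filter_upwards [hVp, hKR, hreal] with q hqV hqR hq
      have hc : Continuous fun z : ℂ => z ^ (j : ℕ) := by fun_prop
      refine (norm_setIntegral_sub_setIntegral_le_const (hγ.isCompact q hqV).measurableSet
        (hγ.isCompact p hp).measurableSet
        (hc.continuousOn.integrableOn_compact (hγ.isCompact q hqV))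
        (hc.continuousOn.integrableOn_compact (hγ.isCompact p hp))
        (area_lt_top_of_subset_ball (hsymm_sub q hqR)) (c := R ^ (j : ℕ)) ?_).trans (by gcongr)
      intro z hz
      rw [norm_pow]
      gcongr
      exact (mem_ball_zero_iff.1 (hsymm_sub q hqR hz)).le
    · simpa using (hnorm0.const_mul C₀).const_mul (R ^ (j : ℕ))
  rw [hasFDerivAt_iff_isLittleO, Asymptotics.isLittleO_iff]
  intro c hc
  -- An integrand bounded by `ε` on a set of area at most `C₀ ‖q - p‖` then contributes at most `c /
  -- 3 * ‖q - p‖`; the `+ 1` covers `C₀ = 0`.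
  set ε := c / (3 * (C₀ + 1)) with hε
  have hεpos : 0 < ε := by positivity
  have hεC : ε * C₀ ≤ c / 3 := by
    have : ε * (C₀ + 1) = c / 3 := by rw [hε]; field_simp
    nlinarith
  obtain ⟨δ, hδ, hsmall⟩ := exists_setIntegral_abs_log_lt R hεpos
  -- The effective potential equals `C` on `K p` and is continuous at its points, so it is within
  -- `ε` of `C` on a neighbourhood of `K p`, which contains every nearby `K q`.
  have hO : ∀ᶠ q in 𝓝 p, K q ⊆
      interior {w | |(-2 * logPot (K p) w + reducedPotential H p.2 w) - C| < ε} := by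
    refine hγ.eventually_subset_of_isOpen hp isOpen_interior fun z hz => ?_
    rw [mem_interior_iff_mem_nhds]
    have h1 := (hcontΦ z hz).sub (continuousAt_const (y := C))
    have h2 := h1.abs.eventually_lt (continuousAt_const (y := ε)) (by simp [← hC z hz, hεpos])
    exact h2
  have hmom : ∀ᶠ q in 𝓝 p, ∑ j : J, 2 *
      (‖interiorMoment (K q) j - interiorMoment (K p) j‖ / ((j : ℕ) : ℝ)) < c / 3 := by
    have : Tendsto (fun q => ∑ j : J, 2 *
        (‖interiorMoment (K q) j - interiorMoment (K p) j‖ / ((j : ℕ) : ℝ))) (𝓝 p)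
        (𝓝 (∑ j : J, 2 *
        (‖interiorMoment (K p) j - interiorMoment (K p) j‖ / ((j : ℕ) : ℝ)))) :=
      tendsto_finsetSum _ fun j _ =>
        ((((hmoment j).sub_const _).norm).div_const _).const_mul 2
    refine this.eventually_lt_const ?_
    simp only [sub_self, norm_zero, zero_div, mul_zero, Finset.sum_const_zero]
    positivity
  filter_upwards [hVp, hKR, hreal, harea0.eventually_lt_const hδ, hO, hmom]
    with q hqV hqR hqarea hqδ hqO hqmom
  have hcq := hγ.isCompact q hqV
  have hcp := hγ.isCompact p hp
  have hpR := hKR.self_of_nhds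
  have hfin := area_lt_top_of_subset_ball (hsymm_sub q hqR)
  have hq0 := (hK.1 q hqV).1
  have hp0 := (hK.1 p hp).1
  have e1 := logTau_potentialAt (H := H) (K := K q) hq0
  have e2 := logTau_potentialAt (H := H) (K := K p) hp0
  have e3 := functional_sub_eq hcq hcp (hWint q hqV p.2) (hWint p hp p.2) (hWint q hqV q.2) C
  have ea : area.real (K q) = q.1 := by
    rw [measureReal_def, hK.area_eq hH hqV, ENNReal.toReal_ofReal hq0.le]
  have eb : area.real (K p) = p.1 := by
    rw [measureReal_def, hK.area_eq hH hp, ENNReal.toReal_ofReal hp0.le]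
  have e4 := setIntegral_reducedPotential_sub (H := H) p.2 q.2 hcq
  have e5 : ∑ j : J, 2 * (interiorMoment (K q) j / ((j : ℕ) : ℂ) * (q.2 j - p.2 j)).re =
      ∑ j : J, 2 * (interiorMoment (K p) j / ((j : ℕ) : ℂ) * (q.2 j - p.2 j)).re +
      ∑ j : J, 2 * ((interiorMoment (K q) j - interiorMoment (K p) j) / ((j : ℕ) : ℂ) *
        (q.2 j - p.2 j)).re := by
    rw [← Finset.sum_add_distrib]
    refine Finset.sum_congr rfl fun j _ => ?_
    rw [← mul_add, ← Complex.add_re]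
    congr 2
    ring
  have b1 : |(∫ z in K q, (logPot (K q) z - logPot (K p) z) ∂area) -
      ∫ z in K p, (logPot (K q) z - logPot (K p) z) ∂area| ≤ c / 3 * ‖q - p‖ := by
    have iA : IntegrableOn (fun z => logPot (K q) z - logPot (K p) z) (K q) area :=
      (integrableOn_logPot hqR hqR hcq.measurableSet).sub
        (integrableOn_logPot hqR hpR hcq.measurableSet)
    have iB : IntegrableOn (fun z => logPot (K q) z - logPot (K p) z) (K p) area :=
      (integrableOn_logPot hpR hqR hcp.measurableSet).sub
        (integrableOn_logPot hpR hpR hcp.measurableSet)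
    refine (norm_setIntegral_sub_setIntegral_le_const hcq.measurableSet hcp.measurableSet iA iB
      hfin (c := ε) fun z hz => ?_).trans ?_
    · exact (abs_logPot_sub_le hcq hcp z).trans
        (hsmall _ (hsymm_sub q hqR) hqδ z (hsymm_sub q hqR hz)).le
    · calc ε * area.real (symmDiff (K q) (K p)) ≤ ε * (C₀ * ‖q - p‖) := by gcongr
        _ = ε * C₀ * ‖q - p‖ := by ring
        _ ≤ c / 3 * ‖q - p‖ := by gcongr
  have b2 : |(∫ z in K q, (-2 * logPot (K p) z + reducedPotential H p.2 z - C) ∂area) -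
      ∫ z in K p, (-2 * logPot (K p) z + reducedPotential H p.2 z - C) ∂area| ≤
      c / 3 * ‖q - p‖ := by
    have iA : IntegrableOn (fun z => -2 * logPot (K p) z + reducedPotential H p.2 z - C)
        (K q) area :=
      (((integrableOn_logPot hqR hpR hcq.measurableSet).const_mul _).add
        (hWint q hqV p.2)).sub (integrableOn_const hcq.measure_lt_top.ne)
    have iB : IntegrableOn (fun z => -2 * logPot (K p) z + reducedPotential H p.2 z - C)
        (K p) area :=
      (((integrableOn_logPot hpR hpR hcp.measurableSet).const_mul _).add
        (hWint p hp p.2)).sub (integrableOn_const hcp.measure_lt_top.ne)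
    refine (norm_setIntegral_sub_setIntegral_le_const hcq.measurableSet hcp.measurableSet iA iB
      hfin (c := ε) fun z hz => ?_).trans ?_
    · rcases hz with hz | hz
      · have h1 := interior_subset (hqO hz.1)
        exact (show |(-2 * logPot (K p) z + reducedPotential H p.2 z) - C| < ε from h1).le
      · rw [hC z hz.1]
        simpa using hεpos.le
    · calc ε * area.real (symmDiff (K q) (K p)) ≤ ε * (C₀ * ‖q - p‖) := by gcongr
        _ = ε * C₀ * ‖q - p‖ := by ring
        _ ≤ c / 3 * ‖q - p‖ := by gcongr
  have b3 : |∑ j : J, 2 * ((interiorMoment (K q) j - interiorMoment (K p) j) / ((j : ℕ) : ℂ) *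
        (q.2 j - p.2 j)).re| ≤ c / 3 * ‖q - p‖ := by
    refine (Finset.abs_sum_le_sum_abs _ _).trans ?_
    refine le_trans (Finset.sum_le_sum (g := fun j : J => 2 *
      (‖interiorMoment (K q) j - interiorMoment (K p) j‖ / ((j : ℕ) : ℝ)) * ‖q - p‖)
      fun j _ => ?_) ?_
    · rw [abs_mul, abs_two, mul_assoc]
      refine mul_le_mul_of_nonneg_left ?_ two_pos.le
      refine (Complex.abs_re_le_norm _).trans ?_
      rw [norm_mul, norm_div, Complex.norm_natCast]
      gcongr
      exact (norm_le_pi_norm (q.2 - p.2) j).trans (norm_snd_le (q - p))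
    · rw [← Finset.sum_mul]
      gcongr
  have key : logTauAt H K q - logTauAt H K p - dLogTau (K p) C (q - p) =
      ((∫ z in K q, (logPot (K q) z - logPot (K p) z) ∂area) -
        ∫ z in K p, (logPot (K q) z - logPot (K p) z) ∂area) -
      ((∫ z in K q, (-2 * logPot (K p) z + reducedPotential H p.2 z - C) ∂area) -
        ∫ z in K p, (-2 * logPot (K p) z + reducedPotential H p.2 z - C) ∂area) +
      ∑ j : J, 2 * ((interiorMoment (K q) j - interiorMoment (K p) j) / ((j : ℕ) : ℂ) *
        (q.2 j - p.2 j)).re := by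
    rw [logTauAt, logTauAt, e1, e2, e3, e4, e5, ea, eb, dLogTau_apply]
    simp only [Prod.fst_sub, Prod.snd_sub, Pi.sub_apply]
    ring
  rw [key, Real.norm_eq_abs]
  calc _ ≤ c / 3 * ‖q - p‖ + c / 3 * ‖q - p‖ + c / 3 * ‖q - p‖ :=
        (abs_add_le _ _).trans (add_le_add ((abs_sub _ _).trans (add_le_add b1 b2)) b3)
    _ = c * ‖q - p‖ := by ring


/-! ### Exterior harmonic moments -/

lemma measurePreserving_rotation (u : Circle) :
    MeasurePreserving (rotation u : ℂ → ℂ) area area :=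
  (rotation u).measurePreserving.smul_measure _

/-- Rotation by the angle `π / l` preserves the annulus and changes the sign of `z⁻ˡ`. -/
lemma setIntegral_annulus_inv_pow (r R : ℝ) {l : ℕ} (hl : 1 ≤ l) :
    ∫ z in Metric.closedBall (0 : ℂ) R \ Metric.ball 0 r, (z ^ l)⁻¹ ∂area = 0 := by
  set u : Circle := Circle.exp (Real.pi / l) with hu
  have hul : (u : ℂ) ^ l = -1 := by
    have hl0 : (l : ℂ) ≠ 0 := by exact_mod_cast (by omega : l ≠ 0)
    rw [hu, Circle.coe_exp, ← Complex.exp_nat_mul, ← Complex.exp_pi_mul_I]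
    congr 1
    push_cast
    field_simp
  have hpre : (rotation u : ℂ → ℂ) ⁻¹' (Metric.closedBall (0 : ℂ) R \ Metric.ball 0 r) =
      Metric.closedBall (0 : ℂ) R \ Metric.ball 0 r := by
    ext z
    simp only [mem_preimage, Set.mem_sdiff, mem_closedBall_zero_iff, mem_ball_zero_iff,
      LinearIsometryEquiv.norm_map]
  have h := (measurePreserving_rotation u).setIntegral_preimage_emb
    (rotation u).toHomeomorph.measurableEmbedding (fun z : ℂ => (z ^ l)⁻¹)
    (Metric.closedBall (0 : ℂ) R \ Metric.ball 0 r)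
  rw [hpre] at h
  simp_rw [rotation_apply, mul_pow, hul, neg_mul, one_mul, inv_neg, integral_neg] at h
  exact self_eq_neg.1 h.symm

lemma integrableOn_inv_pow {A : Set ℂ} (hA : IsCompact A) (h0 : (0 : ℂ) ∉ A) (l : ℕ) :
    IntegrableOn (fun z : ℂ => (z ^ l)⁻¹) A area := by
  refine ContinuousOn.integrableOn_compact hA ?_
  refine ContinuousOn.inv₀ (by fun_prop) fun z hz hzl => h0 ?_
  rwa [← eq_zero_of_pow_eq_zero hzl]

/-- Since the full annulus contributes nothing, the exterior integral can be traded for one over `K`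
minus a disc. This is independent of `R`, so the improper limit exists. -/
lemma truncatedMoment_eq {K : Set ℂ} (hK : IsCompact K) {r R : ℝ} (hr : 0 < r)
    (hrK : Metric.ball 0 r ⊆ K) (hKR : K ⊆ Metric.closedBall 0 R) {l : ℕ} (hl : 1 ≤ l) :
    truncatedMoment K l R = ∫ z in K \ Metric.ball 0 r, (z ^ l)⁻¹ ∂area := by
  have hun : Metric.closedBall (0 : ℂ) R \ Metric.ball 0 r =
      (K \ Metric.ball 0 r) ∪ (Metric.closedBall 0 R \ K) := by
    ext z
    constructor
    · rintro ⟨h1, h2⟩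
      by_cases hz : z ∈ K
      · exact Or.inl ⟨hz, h2⟩
      · exact Or.inr ⟨h1, hz⟩
    · rintro (⟨h1, h2⟩ | ⟨h1, h2⟩)
      · exact ⟨hKR h1, h2⟩
      · exact ⟨h1, fun h => h2 (hrK h)⟩
  have hint : IntegrableOn (fun z : ℂ => (z ^ l)⁻¹)
      (Metric.closedBall (0 : ℂ) R \ Metric.ball 0 r) area :=
    integrableOn_inv_pow ((isCompact_closedBall 0 R).diff Metric.isOpen_ball)
      (fun h => h.2 (Metric.mem_ball_self hr)) l
  have h := setIntegral_annulus_inv_pow r R hl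
  rw [hun] at h hint
  rw [setIntegral_union (disjoint_left.2 fun z h1 h2 => h2.2 h1.1)
    (Metric.isClosed_closedBall.measurableSet.diff hK.measurableSet)
    (hint.mono_set subset_union_left) (hint.mono_set subset_union_right)] at h
  rw [truncatedMoment]
  exact (eq_neg_of_add_eq_zero_left h).symm

lemma tendsto_truncatedMoment {K : Set ℂ} (hK : IsCompact K) {r : ℝ} (hr : 0 < r)
    (hrK : Metric.ball 0 r ⊆ K) {l : ℕ} (hl : 1 ≤ l) :
    Tendsto (truncatedMoment K l) atTop (𝓝 (∫ z in K \ Metric.ball 0 r, (z ^ l)⁻¹ ∂area)) := by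
  obtain ⟨R, hR⟩ := hK.isBounded.subset_closedBall 0
  refine tendsto_const_nhds.congr' ?_
  filter_upwards [eventually_ge_atTop R] with R' hR'
  exact (truncatedMoment_eq hK hr hrK (hR.trans (Metric.closedBall_subset_closedBall hR')) hl).symm

lemma harmonicMoment_eq {K : Set ℂ} (hK : IsCompact K) {r : ℝ} (hr : 0 < r)
    (hrK : Metric.ball 0 r ⊆ K) {l : ℕ} (hl : 1 ≤ l) :
    harmonicMoment K l = ∫ z in K \ Metric.ball 0 r, (z ^ l)⁻¹ ∂area := by
  rw [harmonicMoment, if_neg (by omega), (tendsto_truncatedMoment hK hr hrK hl).limUnder_eq]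

/-- The multipole expansion of the logarithmic potential of a set that avoids a disc. -/
lemma exists_hasSum_logPot {A : Set ℂ} (hA : IsCompact A) {r : ℝ} (hr : 0 < r)
    (hrA : ∀ ζ ∈ A, r ≤ ‖ζ‖) {z : ℂ} (hz : ‖z‖ < r) :
    ∃ w : ℂ, HasSum (fun k : ℕ => (∫ ζ in A, (ζ ^ k)⁻¹ ∂area) / k * z ^ k) w ∧
      w.re = logPot A 0 - logPot A z := by
  have hA0 : (0 : ℂ) ∉ A := fun h => by
    have := hrA 0 h
    simp at this
    linarith
  have hne : ∀ ζ ∈ A, ζ ≠ 0 := fun ζ h h0 => hA0 (h0 ▸ h)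
  have hq : ∀ ζ ∈ A, ‖z / ζ‖ ≤ ‖z‖ / r := fun ζ hζ => by
    rw [norm_div]
    gcongr
    exact hrA ζ hζ
  have hq1 : ‖z‖ / r < 1 := (div_lt_one hr).2 hz
  have hcont : ContinuousOn (fun ζ => z / ζ) A :=
    continuousOn_const.div continuousOn_id hne
  have hint : ∀ k : ℕ, IntegrableOn (fun ζ => (z / ζ) ^ k / k) A area := fun k =>
    ((hcont.pow k).div_const _).integrableOn_compact hA
  have hsum := hasSum_integral_of_summable_integral_norm (μ := area.restrict A)
    (F := fun (k : ℕ) ζ => (z / ζ) ^ k / k) hint <| by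
    refine Summable.of_nonneg_of_le (fun k => integral_nonneg fun _ => norm_nonneg _)
      (f := fun k => (‖z‖ / r) ^ k * area.real A) (fun k => ?_)
      ((summable_geometric_of_lt_one (by positivity) hq1).mul_right _)
    refine (le_abs_self _).trans ?_
    rw [← Real.norm_eq_abs]
    refine norm_setIntegral_le_of_norm_le_const hA.measure_lt_top fun ζ hζ => ?_
    rw [norm_norm, norm_div, norm_pow, Complex.norm_natCast]
    -- The term `k = 0` vanishes because division by zero gives `0`, in agreement with the
    -- logarithmic series.
    rcases Nat.eq_zero_or_pos k with rfl | hk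
    · simp
    · refine (div_le_self (by positivity) (by exact_mod_cast hk)).trans ?_
      gcongr
      exact hq ζ hζ
  have hlog : ∫ ζ in A, ∑' k : ℕ, (z / ζ) ^ k / k ∂area =
      ∫ ζ in A, -Complex.log (1 - z / ζ) ∂area := by
    refine setIntegral_congr_fun hA.measurableSet fun ζ hζ => ?_
    exact (Complex.hasSum_taylorSeries_neg_log ((hq ζ hζ).trans_lt hq1)).tsum_eq
  rw [hlog] at hsum
  refine ⟨∫ ζ in A, -Complex.log (1 - z / ζ) ∂area, ?_, ?_⟩
  · have hterm : ∀ k : ℕ, (∫ ζ in A, (ζ ^ k)⁻¹ ∂area) / k * z ^ k =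
        ∫ ζ in A, (z / ζ) ^ k / k ∂area := by
      intro k
      rw [div_mul_eq_mul_div, mul_comm, ← integral_const_mul, ← integral_div]
      congr 1 with ζ
      rw [div_pow]
      ring
    simp_rw [hterm]
    exact hsum
  · have hli : IntegrableOn (fun ζ => -Complex.log (1 - z / ζ)) A area := by
      refine ContinuousOn.integrableOn_compact hA (ContinuousOn.neg ?_)
      refine (continuousOn_const.sub hcont).clog fun ζ hζ => ?_
      refine Or.inl ?_
      have := (Complex.abs_re_le_norm (z / ζ)).trans_lt ((hq ζ hζ).trans_lt hq1)
      simp only [Pi.sub_apply, Complex.sub_re, Complex.one_re]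
      linarith [(abs_lt.1 this).2]
    have h := integral_re hli
    simp only [RCLike.re_to_complex] at h
    rw [← h, logPot, logPot, ← integral_sub (integrableOn_log_sub hA.isBounded 0)
      (integrableOn_log_sub hA.isBounded z)]
    refine setIntegral_congr_fun hA.measurableSet fun ζ hζ => ?_
    have hzζ : z - ζ ≠ 0 := by
      intro h0
      rw [sub_eq_zero] at h0
      exact absurd (hrA ζ hζ) (not_le.2 (h0 ▸ hz))
    have h1 : 1 - z / ζ = -(z - ζ) / ζ := by
      have := hne ζ hζ
      field_simp
      ring
    simp only [Complex.neg_re, Complex.log_re, zero_sub, norm_neg]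
    rw [h1, norm_div, norm_neg, Real.log_div (norm_ne_zero_iff.2 hzζ)
      (norm_ne_zero_iff.2 (hne ζ hζ))]
    ring

/-- A power series whose real part is constant near `0` is constant. -/
lemma coeff_eq_zero_of_re_const {c : ℕ → ℂ} {G : ℂ → ℂ} {a : ℝ}
    (hsum : ∀ᶠ z in 𝓝 (0 : ℂ), HasSum (fun k => c k * z ^ k) (G z))
    (hre : ∀ᶠ z in 𝓝 (0 : ℂ), (G z).re = a) {k : ℕ} (hk : 1 ≤ k) : c k = 0 := by
  have hp : HasFPowerSeriesAt G (FormalMultilinearSeries.ofScalars ℂ c) 0 := by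
    rw [hasFPowerSeriesAt_iff]
    filter_upwards [hsum] with z hz
    simpa [FormalMultilinearSeries.coeff_ofScalars, mul_comm] using hz
  obtain ⟨ρ, hρ, hball⟩ := Metric.eventually_nhds_iff_ball.1
    (hp.analyticAt.eventually_analyticAt.and hre)
  obtain ⟨b, hb⟩ := AnalyticOnNhd.eq_const_of_re_eq_const (U := Metric.ball (0 : ℂ) ρ)
    (fun z hz => (hball z hz).1) (fun z hz => (hball z hz).2) Metric.isOpen_ball
    ((convex_ball (0 : ℂ) ρ).isConnected ⟨0, Metric.mem_ball_self hρ⟩)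
  have hconst : HasFPowerSeriesAt G (constFormalMultilinearSeries ℂ ℂ b) 0 := by
    refine (hasFPowerSeriesAt_const (c := b)).congr ?_
    filter_upwards [Metric.ball_mem_nhds (0 : ℂ) hρ] with z hz
    exact (hb z hz).symm
  rw [← FormalMultilinearSeries.coeff_ofScalars (𝕜 := ℂ) (p := c) (n := k),
    hp.eq_formalMultilinearSeries hconst, FormalMultilinearSeries.coeff,
    constFormalMultilinearSeries_apply_of_nonzero (show k ≠ 0 by omega)]
  rfl

/-- The `l`-th component of `s`, or `0` if `l ∉ J`. -/
def timeCoeff {J : Finset ℕ} (s : J → ℂ) (l : ℕ) : ℂ := if h : l ∈ J then s ⟨l, h⟩ else 0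

lemma hasSum_perturbPoly {J : Finset ℕ} (s : J → ℂ) (z : ℂ) :
    HasSum (fun k : ℕ => timeCoeff s k / k * z ^ k) (perturbPoly s z) := by
  have h1 : perturbPoly s z = ∑ k ∈ J, timeCoeff s k / k * z ^ k := by
    rw [perturbPoly, ← Finset.sum_coe_sort J]
    refine Finset.sum_congr rfl fun j _ => ?_
    rw [timeCoeff, dif_pos j.2]
  rw [h1]
  refine hasSum_sum_of_ne_finset_zero fun k hk => ?_
  rw [timeCoeff, dif_neg hk, zero_div, zero_mul]

/-- The exterior moments of two droplets differ as the times do. -/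
lemma harmonicMoment_sub {H : ℂ → ℝ} {J : Finset ℕ} {s s' : J → ℂ} {K K' : Set ℂ}
    (hK : IsCompact K) (hK' : IsCompact K') {r : ℝ} (hr : 0 < r)
    (hrK : Metric.ball 0 r ⊆ K) (hrK' : Metric.ball 0 r ⊆ K') {C C' : ℝ}
    (hC : ∀ z ∈ K, -2 * logPot K z + reducedPotential H s z = C)
    (hC' : ∀ z ∈ K', -2 * logPot K' z + reducedPotential H s' z = C') {l : ℕ} (hl : 1 ≤ l) :
    harmonicMoment K' l = harmonicMoment K l + (timeCoeff s' l - timeCoeff s l) := by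
  set A := K \ Metric.ball 0 r with hA
  set A' := K' \ Metric.ball 0 r with hA'
  have cA : IsCompact A := hK.diff Metric.isOpen_ball
  have cA' : IsCompact A' := hK'.diff Metric.isOpen_ball
  have rA : ∀ ζ ∈ A, r ≤ ‖ζ‖ := fun ζ h => not_lt.1 fun h' => h.2 (mem_ball_zero_iff.2 h')
  have rA' : ∀ ζ ∈ A', r ≤ ‖ζ‖ := fun ζ h => not_lt.1 fun h' => h.2 (mem_ball_zero_iff.2 h')
  -- The potential of the common disc cancels between `K` and `K'`; the remainders avoid the disc
  -- and so have a multipole expansion in it.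
  have hsplit : ∀ (B : Set ℂ), IsCompact B → Metric.ball 0 r ⊆ B → ∀ z,
      logPot B z = logPot (Metric.ball 0 r) z + logPot (B \ Metric.ball 0 r) z := by
    intro B hB hrB z
    have := integral_inter_add_sdiff (f := fun ζ => Real.log ‖z - ζ‖) (μ := area)
      (measurableSet_ball (x := (0 : ℂ)) (ε := r)) (integrableOn_log_sub hB.isBounded z)
    rw [inter_eq_right.2 hrB] at this
    exact this.symm
  have hex : ∀ z : ℂ, ‖z‖ < r → ∃ w : ℂ, HasSum (fun k : ℕ =>
      (((∫ ζ in A', (ζ ^ k)⁻¹ ∂area) - timeCoeff s' k) -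
        ((∫ ζ in A, (ζ ^ k)⁻¹ ∂area) - timeCoeff s k)) / k * z ^ k) w ∧
      w.re = (logPot A' 0 - logPot A 0) + (C' - C) / 2 := by
    intro z hz
    obtain ⟨w, hw, hwre⟩ := exists_hasSum_logPot cA hr rA hz
    obtain ⟨w', hw', hwre'⟩ := exists_hasSum_logPot cA' hr rA' hz
    refine ⟨(w' - perturbPoly s' z) - (w - perturbPoly s z), ?_, ?_⟩
    · have h := (hw'.sub (hasSum_perturbPoly s' z)).sub (hw.sub (hasSum_perturbPoly s z))
      simpa only [sub_div, sub_mul] using h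
    · have hzb : z ∈ Metric.ball (0 : ℂ) r := mem_ball_zero_iff.2 hz
      have h1 := hC z (hrK hzb)
      have h2 := hC' z (hrK' hzb)
      rw [hsplit K hK hrK, reducedPotential_eq] at h1
      rw [hsplit K' hK' hrK', reducedPotential_eq] at h2
      rw [Complex.sub_re, Complex.sub_re, Complex.sub_re, hwre, hwre']
      linarith
  choose! G hG using hex
  have hnear : ∀ᶠ z in 𝓝 (0 : ℂ), ‖z‖ < r := by
    filter_upwards [Metric.ball_mem_nhds (0 : ℂ) hr] with z hz
    exact mem_ball_zero_iff.1 hz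
  have h0 := coeff_eq_zero_of_re_const (hnear.mono fun z hz => (hG z hz).1)
    (hnear.mono fun z hz => (hG z hz).2) hl
  have hl0 : (l : ℂ) ≠ 0 := by exact_mod_cast (by omega : l ≠ 0)
  rw [div_eq_zero_iff, or_iff_left hl0] at h0
  rw [harmonicMoment_eq hK hr hrK hl, harmonicMoment_eq hK' hr hrK' hl]
  linear_combination h0

lemma IsSmoothDropletFamily.exists_robin {H : ℂ → ℝ} (hH : IsAlgebraic H) {J : Finset ℕ}
    {V : Set (Times J)} (hV : IsOpen V) {K : Times J → Set ℂ}
    (hK : IsSmoothDropletFamily H V K) {q : Times J} (hq : q ∈ V) :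
    ∃ C : ℝ, ∀ z ∈ K q, -2 * logPot (K q) z + reducedPotential H q.2 z = C := by
  obtain ⟨γ, hγ⟩ := hK.exists_jordanFamily hH hV
  obtain ⟨S, hS⟩ := hK.isDroplet hq
  exact robin_of_isDroplet hH (hK.1 q hq).1 hS (hγ.area_frontier hq)

lemma harmonicMoment_zero_eq {H : ℂ → ℝ} (hH : IsAlgebraic H) {J : Finset ℕ}
    {V : Set (Times J)} {K : Times J → Set ℂ} (hK : IsSmoothDropletFamily H V K) {q : Times J}
    (hq : q ∈ V) : harmonicMoment (K q) 0 = q.1 := by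
  rw [harmonicMoment, if_pos rfl, hK.area_eq hH hq, ENNReal.toReal_ofReal (hK.1 q hq).1.le]

lemma eventually_harmonicMoment_eq {H : ℂ → ℝ} (hH : IsAlgebraic H) {J : Finset ℕ}
    {V : Set (Times J)} (hV : IsOpen V) {K : Times J → Set ℂ}
    (hK : IsSmoothDropletFamily H V K) {p : Times J} (hp : p ∈ V) (h0 : 0 ∈ interior (K p))
    {l : ℕ} (hl : 1 ≤ l) : ∀ᶠ q in 𝓝 p,
      harmonicMoment (K q) l = harmonicMoment (K p) l + (timeCoeff q.2 l - timeCoeff p.2 l) := by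
  obtain ⟨γ, hγ⟩ := hK.exists_jordanFamily hH hV
  obtain ⟨r, hr, hball⟩ :=
    Metric.nhds_basis_closedBall.mem_iff.1 (isOpen_interior.mem_nhds h0)
  -- One disc about `0` lies in `K p` and in all nearby `K q`, as the comparison of moments
  -- requires.
  filter_upwards [hV.mem_nhds hp, hγ.eventually_closedBall_subset hp hr hball] with q hqV hq
  obtain ⟨C, hC⟩ := hK.exists_robin hH hV hp
  obtain ⟨C', hC'⟩ := hK.exists_robin hH hV hqV
  exact harmonicMoment_sub (hγ.isCompact p hp) (hγ.isCompact q hqV) hr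
    (Metric.ball_subset_closedBall.trans (hball.trans interior_subset))
    (Metric.ball_subset_closedBall.trans hq) hC hC' hl

/-! ### Wirtinger derivatives along the times -/

lemma tendsto_update {J : Finset ℕ} (p : Times J) (j : J) :
    Tendsto (fun s : ℂ => ((p.1, Function.update p.2 j s) : Times J)) (𝓝 (p.2 j)) (𝓝 p) := by
  have : Continuous (fun s : ℂ => ((p.1, Function.update p.2 j s) : Times J)) :=
    continuous_const.prodMk (continuous_const.update j continuous_id)
  simpa using this.tendsto (p.2 j)

lemma tendsto_prodMk {J : Finset ℕ} (p : Times J) :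
    Tendsto (fun t : ℝ => ((t, p.2) : Times J)) (𝓝 p.1) (𝓝 p) :=
  Continuous.tendsto (by fun_prop : Continuous fun t : ℝ => ((t, p.2) : Times J)) p.1

lemma hasFDerivAt_slice_harmonicMoment {H : ℂ → ℝ} (hH : IsAlgebraic H) {J : Finset ℕ}
    (hJ : ∀ j ∈ J, 1 ≤ j) {V : Set (Times J)} (hV : IsOpen V) {K : Times J → Set ℂ}
    (hK : IsSmoothDropletFamily H V K) {p : Times J} (hp : p ∈ V) (h0 : 0 ∈ interior (K p))
    (l : ℕ) (j : J) :
    HasFDerivAt (slice (fun q => harmonicMoment (K q) l) p j)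
      (if l = (j : ℕ) then ContinuousLinearMap.id ℝ ℂ else 0) (p.2 j) := by
  have hev := tendsto_update p j
  rcases Nat.eq_zero_or_pos l with rfl | hl
  -- Positivity of `j` rules out `j = l = 0`; the zeroth moment is `t₀`, fixed along the slice.
  · rw [if_neg (by have := hJ j j.2; omega)]
    refine (hasFDerivAt_const (p.1 : ℂ) (p.2 j)).congr_of_eventuallyEq ?_
    filter_upwards [hev (hV.mem_nhds hp)] with s hs
    exact harmonicMoment_zero_eq hH hK hs
  · have heq := hev.eventually (eventually_harmonicMoment_eq hH hV hK hp h0 hl)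
    split_ifs with hlj
    · refine (((hasFDerivAt_id (𝕜 := ℝ) (p.2 j)).sub_const (p.2 j)).const_add
        (harmonicMoment (K p) l)).congr_of_eventuallyEq ?_
      filter_upwards [heq] with s hs
      subst hlj
      rw [slice, hs]
      simp [timeCoeff]
    · refine (hasFDerivAt_const (harmonicMoment (K p) l) (p.2 j)).congr_of_eventuallyEq ?_
      filter_upwards [heq] with s hs
      rw [slice, hs]
      have : timeCoeff (Function.update p.2 j s) l = timeCoeff p.2 l := by
        unfold timeCoeff
        split_ifs with h
        · exact Function.update_of_ne (fun h' => hlj (congrArg Subtype.val h')) _ _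
        · rfl
      simp [this]

lemma hasDerivAt_harmonicMoment {H : ℂ → ℝ} (hH : IsAlgebraic H) {J : Finset ℕ}
    {V : Set (Times J)} (hV : IsOpen V) {K : Times J → Set ℂ}
    (hK : IsSmoothDropletFamily H V K) {p : Times J} (hp : p ∈ V) (h0 : 0 ∈ interior (K p))
    (l : ℕ) : HasDerivAt (fun t : ℝ => harmonicMoment (K (t, p.2)) l)
      (if l = 0 then 1 else 0) p.1 := by
  have hev := tendsto_prodMk p
  split_ifs with hl
  · subst hl
    refine (HasDerivAt.ofReal_comp (hasDerivAt_id p.1)).congr_of_eventuallyEq ?_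
    filter_upwards [hev (hV.mem_nhds hp)] with t ht
    exact harmonicMoment_zero_eq hH hK ht
  · refine (hasDerivAt_const p.1 (harmonicMoment (K p) l)).congr_of_eventuallyEq ?_
    filter_upwards [hev.eventually
      (eventually_harmonicMoment_eq hH hV hK hp h0 (Nat.pos_of_ne_zero hl))] with t ht
    rw [ht]
    simp

lemma hasFDerivAt_slice_logTauAt {H : ℂ → ℝ} {J : Finset ℕ} {K : Times J → Set ℂ} {p : Times J}
    {L : Times J →L[ℝ] ℝ} (hL : HasFDerivAt (logTauAt H K) L p) (j : J) :
    HasFDerivAt (slice (fun q => (logTauAt H K q : ℂ)) p j)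
      (Complex.ofRealCLM.comp (L.comp ((0 : ℂ →L[ℝ] ℝ).prod
        (ContinuousLinearMap.pi (Pi.single j (ContinuousLinearMap.id ℝ ℂ)))))) (p.2 j) := by
  have h1 : HasFDerivAt (fun s : ℂ => ((p.1, Function.update p.2 j s) : Times J))
      ((0 : ℂ →L[ℝ] ℝ).prod
        (ContinuousLinearMap.pi (Pi.single j (ContinuousLinearMap.id ℝ ℂ)))) (p.2 j) :=
    (hasFDerivAt_const p.1 (p.2 j)).prodMk (hasFDerivAt_update p.2 (p.2 j))
  have h2 : HasFDerivAt (logTauAt H K) L (p.1, Function.update p.2 j (p.2 j)) := by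
    simpa using hL
  exact Complex.ofRealCLM.hasFDerivAt.comp (p.2 j)
    (HasFDerivAt.comp (g := logTauAt H K) (p.2 j) h2 h1)

/-- Along the slice the differential is `v ↦ 2 Re (a v)` with `a = M_j / j`, that is `a v` plus its
conjugate, whose Wirtinger `∂`-derivative is `a`. -/
lemma dz_slice_logTauAt {H : ℂ → ℝ} {J : Finset ℕ} {K : Times J → Set ℂ} {p : Times J} {C : ℝ}
    (hL : HasFDerivAt (logTauAt H K) (dLogTau (K p) C) p) (j : J) :
    dz (slice (fun q => (logTauAt H K q : ℂ)) p j) (p.2 j) =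
      interiorMoment (K p) j / ((j : ℕ) : ℂ) := by
  have hsingle (v : ℂ) : ∑ i : J, 2 * (interiorMoment (K p) i / ((i : ℕ) : ℂ) *
      (Pi.single j (ContinuousLinearMap.id ℝ ℂ) : J → ℂ →L[ℝ] ℂ) i v).re =
      2 * (interiorMoment (K p) j / ((j : ℕ) : ℂ) * v).re := by
    rw [Finset.sum_eq_single j]
    · simp
    · intro i _ hij
      simp [Pi.single_eq_of_ne hij]
    · simp
  rw [dz, (hasFDerivAt_slice_logTauAt hL j).fderiv]
  simp only [ContinuousLinearMap.comp_apply, dLogTau_apply, ContinuousLinearMap.prod_apply,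
    zero_apply, ContinuousLinearMap.pi_apply, hsingle]
  apply Complex.ext <;> simp

end HeleShaw

end

open HeleShaw in
theorem lemma4p3 (H : ℂ → ℝ) (hH : IsAlgebraic H)
    (J : Finset ℕ) (hJ : ∀ j ∈ J, 1 ≤ j)
    (V : Set (Times J)) (hV : IsOpen V) (K : Times J → Set ℂ)
    (hK : IsSmoothDropletFamily H V K) (p : Times J) (hp : p ∈ V) :
    -- `∂ log τ / ∂t_j = M_j / j` for `j ≥ 1`
    (∀ j : J,
      DifferentiableAt ℝ (slice (fun q => (logTauAt H K q : ℂ)) p j) (p.2 j) ∧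
      dz (slice (fun q => (logTauAt H K q : ℂ)) p j) (p.2 j) =
        interiorMoment (K p) j / ((j : ℕ) : ℂ)) ∧
    -- `∂ log τ / ∂t₀ = -C_Q`, where `C_Q` is the Robin constant
    (∃ C : ℝ, IsRobinConstant p.1 (potentialAt H p) (K p) C ∧
      HasDerivAt (fun t : ℝ => logTauAt H K (t, p.2)) (-C) p.1) ∧
    -- the exterior harmonic moments satisfy `∂t_l / ∂t_j = δ_{jl}` and `∂t_l / ∂t̄_j = 0`
    (0 ∈ interior (K p) →
      (∀ l : ℕ, 1 ≤ l → Tendsto (truncatedMoment (K p) l) atTop (𝓝 (harmonicMoment (K p) l))) ∧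
      (∀ l : ℕ, ∀ j : J,
        DifferentiableAt ℝ (slice (fun q => harmonicMoment (K q) l) p j) (p.2 j) ∧
        dz (slice (fun q => harmonicMoment (K q) l) p j) (p.2 j) =
          (if l = (j : ℕ) then 1 else 0) ∧
        dzbar (slice (fun q => harmonicMoment (K q) l) p j) (p.2 j) = 0) ∧
      (∀ l : ℕ, HasDerivAt (fun t : ℝ => harmonicMoment (K (t, p.2)) l)
        (if l = 0 then 1 else 0) p.1)) ∧
    -- the global droplet
    (IsDroplet (potentialAt H p) univ (K p) →
      ∀ μ : Measure ℂ, IsEquilibriumMeasure (potentialAt H p) univ μ →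
        logTauAt H K p = -p.1 ^ 2 * energy (potentialAt H p) μ) := by
  obtain ⟨C, hC⟩ := hK.exists_robin hH hV hp
  obtain ⟨γ, hγ⟩ := hK.exists_jordanFamily hH hV
  have hp0 := (hK.1 p hp).1
  have hτ := hasFDerivAt_logTauAt hH hV hK hp hC
  refine ⟨fun j => ⟨(hasFDerivAt_slice_logTauAt hτ j).differentiableAt, dz_slice_logTauAt hτ j⟩,
    ⟨C, isRobinConstant_of_eq hp0 hC, ?_⟩, fun h0 => ⟨fun l hl => ?_, fun l j => ?_,
      hasDerivAt_harmonicMoment hH hV hK hp h0⟩, fun hS μ hμ => logTau_eq_energy hH hp0 hS hμ⟩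
  · have h1 : HasDerivAt (fun t : ℝ => ((t, p.2) : Times J)) (1, 0) p.1 :=
      (hasDerivAt_id p.1).prodMk (hasDerivAt_const p.1 p.2)
    have h2 := HasFDerivAt.comp_hasDerivAt (l := logTauAt H K) p.1 hτ h1
    have h3 : dLogTau (J := J) (K p) C (1, 0) = -C := by simp [dLogTau_apply]
    rwa [h3] at h2
  · obtain ⟨r, hr, hball⟩ := Metric.nhds_basis_ball.mem_iff.1 (isOpen_interior.mem_nhds h0)
    have hsub := hball.trans interior_subset
    rw [harmonicMoment_eq (hγ.isCompact p hp) hr hsub hl]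
    exact tendsto_truncatedMoment (hγ.isCompact p hp) hr hsub hl
  · have h := hasFDerivAt_slice_harmonicMoment hH hJ hV hK hp h0 l j
    refine ⟨h.differentiableAt, ?_, ?_⟩
    · rw [dz, h.fderiv]
      split_ifs
      · simp
        norm_num
      · simp
    · rw [dzbar, h.fderiv]
      split_ifs <;> simp
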